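/- Let $d\ge 2$, let $f\in\mathcal E'(\mathbb R^d)$ be a compactly supported (complex-valued) distribution, let $V\subset\mathbb R^d$ be a nonempty open set with $f|_V=0$, and let $x_0\in V$. (i) Let $\alpha\in\mathbb R$ with either $\alpha=d-1$, or $\alpha\notin\mathbb Z$ and $\alpha<d$. Let $I_\alpha f=f*|\cdot|^{-\alpha}$ be the Riesz potential, i.e. $\langle I_\alpha f,\varphi\rangle=\langle f,\,|\cdot|^{-\alpha}*\varphi\rangle$ for $\varphi\in C_c^\infty(\mathbb R^d)$. Then $I_\alpha f$ is a smooth function in $V$; and if it vanishes to infinite order at $x_0$, that is, $\partial^\beta(I_\alpha f)(x_0)=0$ for all multi-indices $\beta\in\mathbb N^d$ (including $\beta=0$), then $f=0$. (ii) The same holds for the normal operator $N=X^*X$ of the X-ray transform in place of $I_\alpha$: $Nf$ is a smooth function in $V$, and if $\partial^\beta(Nf)(x_0)=0$ for all $\beta\in\mathbb N^d$, then $f=0$. Here oriented lines are parametrized by pairs $(z,\theta)$ with $\theta\in S^{d-1}$ and $z\perp\theta$. For functions, $X\varphi(z,\theta)=\int_{\mathbb R}\varphi(z+s\theta)\,ds$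 and $X^*\eta(x)=\int_{S^{d-1}}\eta(x-(x\cdot\theta)\theta,\theta)\,d\theta$. For distributions, $X$ and $X^*$ are defined by duality, $\langle Xf,\eta\rangle=\langle f,X^*\eta\rangle$ and $\langle X^*g,\varphi\rangle=\langle g,X\varphi\rangle$, so that $\langle Nf,\varphi\rangle=\langle f,X^*X\varphi\rangle$ for $\varphi\in C_c^\infty(\mathbb R^d)$. -/

import Mathlib

open Set Filter Topology MeasureTheory TopologicalSpace
open scoped Distributions ContDiff Convolution Manifold

/-- The Euclidean space `ℝ^d`. -/
abbrev Rd (d : ℕ) : Type := EuclideanSpace ℝ (Fin d)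

/-- Complex-valued distributions on `ℝ^d`. A complex distribution is determined by its values on
real-valued test functions, so it is an `ℝ`-linear continuous map `𝓓(ℝ^d, ℝ) → ℂ`. -/
abbrev Distn (d : ℕ) : Type := 𝓓'((⊤ : Opens (Rd d)), ℂ)

/-- Real-valued test functions on `ℝ^d`. -/
abbrev TestFn (d : ℕ) : Type := 𝓓((⊤ : Opens (Rd d)), ℝ)

namespace Distn

variable {d : ℕ}

/-- A distribution vanishes on the complement of its support: it kills every test function
whose support is disjoint from the support of the distribution. -/
theorem apply_eq_zero_of_tsupport_subset (f : Distn d) (φ : TestFn d)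
    (hφ : tsupport φ ⊆ (Distribution.dsupport f)ᶜ) : f φ = 0 := by
  have key : ∃ O : Set (Rd d), IsOpen O ∧ tsupport φ ⊆ O ∧
      Distribution.IsVanishingOn f O := by
    have hc : IsCompact (tsupport φ) := φ.hasCompactSupport
    refine hc.induction_on (p := fun s => ∃ O : Set (Rd d), IsOpen O ∧ s ⊆ O ∧
      Distribution.IsVanishingOn f O) ?_ ?_ ?_ ?_
    · refine ⟨∅, isOpen_empty, subset_rfl, fun u hu => ?_⟩
      have : u = 0 := by
        ext x
        exact image_eq_zero_of_notMem_tsupport (fun hx => hu hx)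
      rw [this, map_zero]
    · rintro s t hst ⟨O, hO, htO, hv⟩
      exact ⟨O, hO, hst.trans htO, hv⟩
    · rintro s t ⟨O₁, hO₁, hs, hv₁⟩ ⟨O₂, hO₂, ht, hv₂⟩
      refine ⟨O₁ ∪ O₂, hO₁.union hO₂, union_subset_union hs ht, fun u hu => ?_⟩
      have hcl : IsClosed (tsupport u \ O₂) := (isClosed_tsupport u).sdiff hO₂
      have hsub : tsupport u \ O₂ ⊆ O₁ := fun x hx => (hu hx.1).resolve_right hx.2
      have hdisj : Disjoint O₁ᶜ (tsupport u \ O₂) :=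
        disjoint_left.2 fun x hx hx' => hx (hsub hx')
      obtain ⟨χ, hχ0, hχ1, -⟩ := exists_contMDiffMap_zero_one_nhds_of_isClosed
        (n := (⊤ : ℕ∞)) 𝓘(ℝ, Rd d) hO₁.isClosed_compl hcl hdisj
      have hχs : ContDiff ℝ ∞ χ := χ.contMDiff.contDiff
      have hχt : tsupport χ ⊆ O₁ := by
        intro x hx
        by_contra hxO
        have h0 : ∀ᶠ y in 𝓝 x, χ y = 0 := hχ0.filter_mono (nhds_le_nhdsSet hxO)
        exact (notMem_tsupport_iff_eventuallyEq.2 h0) hx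
      have hm1 : tsupport (fun x => χ x * u x) ⊆ tsupport u := tsupport_mul_subset_right
      have hm2 : tsupport (fun x => (1 - χ x) * u x) ⊆ tsupport u := tsupport_mul_subset_right
      let u₁ : TestFn d := ⟨fun x => χ x * u x, hχs.mul u.contDiff,
        u.hasCompactSupport.mul_left, subset_univ _⟩
      let u₂ : TestFn d := ⟨fun x => (1 - χ x) * u x, (contDiff_const.sub hχs).mul u.contDiff,
        u.hasCompactSupport.mul_left, subset_univ _⟩
      have hu12 : u = u₁ + u₂ := by
        ext x
        change u x = χ x * u x + (1 - χ x) * u x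
        ring
      have h1 : f u₁ = 0 := hv₁ u₁ ((tsupport_mul_subset_left (f := χ) (g := u)).trans hχt)
      have h2 : f u₂ = 0 := by
        refine hv₂ u₂ fun x hx => ?_
        by_contra hxO
        have h0 : ∀ᶠ y in 𝓝 x, χ y = 1 :=
          hχ1.filter_mono (nhds_le_nhdsSet (show x ∈ tsupport u \ O₂ from ⟨hm2 hx, hxO⟩))
        refine (notMem_tsupport_iff_eventuallyEq.2 ?_) hx
        filter_upwards [h0] with y hy
        change (1 - χ y) * u y = 0
        rw [hy]; ring
      rw [hu12, map_add, h1, h2, add_zero]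
    · intro x hx
      obtain ⟨s, hs, hso, hxs⟩ := (Distribution.notMem_dsupport_iff x).1 (hφ hx)
      exact ⟨s, mem_nhdsWithin_of_mem_nhds (hso.mem_nhds hxs), s, hso, subset_rfl, hs⟩
  obtain ⟨O, -, hO, hv⟩ := key
  exact hv φ hO

open Classical in
/-- The pairing `⟨f, ψ⟩` of a distribution with a function `ψ` on `ℝ^d`: the value of `f` at any
test function that agrees with `ψ` near the support of `f` (see `pairing_eq` for the independence
of the choice). If `f` has compact support, this is the canonical extension
of `f` to all smooth functions `ψ` (see `exists_test_eventuallyEq` for the existence). -/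
noncomputable def pairing (f : Distn d) (ψ : Rd d → ℝ) : ℂ :=
  if h : ∃ φ : TestFn d, ∀ᶠ x in 𝓝ˢ (Distribution.dsupport f), φ x = ψ x then f h.choose else 0

theorem pairing_eq (f : Distn d) (ψ : Rd d → ℝ) (φ : TestFn d)
    (hφ : ∀ᶠ x in 𝓝ˢ (Distribution.dsupport f), φ x = ψ x) : pairing f ψ = f φ := by
  have h : ∃ φ : TestFn d, ∀ᶠ x in 𝓝ˢ (Distribution.dsupport f), φ x = ψ x := ⟨φ, hφ⟩
  rw [pairing, dif_pos h, ← sub_eq_zero, ← map_sub]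
  refine apply_eq_zero_of_tsupport_subset f _ fun x hx hxs => ?_
  refine (notMem_tsupport_iff_eventuallyEq.2 ?_) hx
  filter_upwards [h.choose_spec.filter_mono (nhds_le_nhdsSet hxs),
    hφ.filter_mono (nhds_le_nhdsSet hxs)] with y hy hy'
  change h.choose y - φ y = 0
  rw [hy, hy', sub_self]

theorem exists_test_eventuallyEq (f : Distn d) (hf : IsCompact (Distribution.dsupport f))
    (ψ : Rd d → ℝ) (hψ : ContDiff ℝ ∞ ψ) :
    ∃ φ : TestFn d, ∀ᶠ x in 𝓝ˢ (Distribution.dsupport f), φ x = ψ x := by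
  obtain ⟨K, hK, hfK⟩ := exists_compact_superset hf
  obtain ⟨χ, hχ0, hχ1, -⟩ := exists_contMDiffMap_zero_one_nhds_of_isClosed
    (n := (⊤ : ℕ∞)) 𝓘(ℝ, Rd d) isOpen_interior.isClosed_compl hf.isClosed
    (disjoint_left.2 fun x hx hx' => hx (hfK hx'))
  have hχc : HasCompactSupport χ := by
    refine HasCompactSupport.intro hK fun x hx => ?_
    exact hχ0.self_of_nhdsSet x fun hx' => hx (interior_subset hx')
  refine ⟨⟨fun x => χ x * ψ x, χ.contMDiff.contDiff.mul hψ, hχc.mul_right, subset_univ _⟩, ?_⟩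
  filter_upwards [hχ1] with x hx
  change χ x * ψ x = ψ x
  rw [hx, one_mul]

/-- The convolution `f * v` of a compactly supported distribution `f` with the distribution given
by a locally integrable function `v`, as a functional on test functions:
`⟨f * v, φ⟩ = ⟨f, ṽ * φ⟩` with `ṽ x = v (-x)`. -/
noncomputable def conv (f : Distn d) (v : Rd d → ℝ) : TestFn d → ℂ := fun φ =>
  pairing f ((fun x => v (-x)) ⋆[ContinuousLinearMap.mul ℝ ℝ, volume] φ)

end Distn

/-- The Riesz potential `I_α f = f * |x|^{-α}` of a compactly supported distribution, as a
functional on test functions. -/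
noncomputable def rieszPotential {d : ℕ} (α : ℝ) (f : Distn d) : TestFn d → ℂ :=
  f.conv fun x => ‖x‖ ^ (-α)

/-- The set `Γ` of oriented lines in `ℝ^d`: the pairs `(z, θ)` with `θ` in the unit sphere and `z`
orthogonal to `θ` stand for the line `{z + s θ : s ∈ ℝ}`. -/
abbrev OrientedLine (d : ℕ) : Type :=
  {p : Rd d × Metric.sphere (0 : Rd d) 1 // inner ℝ p.1 (p.2 : Rd d) = 0}

/-- The oriented line through `x` with direction `θ`, that is `(x - (x · θ) θ, θ)`. -/
noncomputable def lineThrough {d : ℕ} (x : Rd d) (θ : Metric.sphere (0 : Rd d) 1) :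
    OrientedLine d :=
  ⟨(x - inner ℝ x (θ : Rd d) • (θ : Rd d), θ), by
    have h : ‖(θ : Rd d)‖ = 1 := norm_eq_of_mem_sphere θ
    simp [inner_sub_left, inner_smul_left, h]⟩

/-- The X-ray transform of a function: `X φ (z, θ) = ∫ φ (z + s θ) ds`. -/
noncomputable def xray {d : ℕ} (φ : Rd d → ℝ) : OrientedLine d → ℝ := fun γ =>
  ∫ s : ℝ, φ (γ.1.1 + s • (γ.1.2 : Rd d))

/-- The formal adjoint of the X-ray transform on functions: the integral over all lines through
`x`, with respect to the surface measure of the unit sphere. -/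
noncomputable def xrayAdjoint {d : ℕ} (η : OrientedLine d → ℝ) : Rd d → ℝ := fun x =>
  ∫ θ, η (lineThrough x θ) ∂(volume : Measure (Rd d)).toSphere

/-- The X-ray transform of a compactly supported distribution, by duality:
`⟨X f, η⟩ = ⟨f, X^* η⟩` for smooth `η` on the set of lines. -/
noncomputable def xrayDist {d : ℕ} (f : Distn d) : (OrientedLine d → ℝ) → ℂ := fun η =>
  f.pairing (xrayAdjoint η)

/-- The adjoint of the X-ray transform on functionals on the set of lines, by duality:
`⟨X^* g, φ⟩ = ⟨g, X φ⟩` for test functions `φ`. -/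
noncomputable def xrayAdjointDist {d : ℕ} (g : (OrientedLine d → ℝ) → ℂ) : TestFn d → ℂ := fun φ =>
  g (xray φ)

/-- The normal operator `N = X^* X` of the X-ray transform on compactly supported
distributions. -/
noncomputable def normalOperator {d : ℕ} (f : Distn d) : TestFn d → ℂ :=
  xrayAdjointDist (xrayDist f)

/-- On the open set `U`, the functional `T` on test functions is given by the smooth function
`u`. -/
def IsGivenOnBy {d : ℕ} (T : TestFn d → ℂ) (U : Set (Rd d)) (u : Rd d → ℂ) : Prop :=
  ContDiffOn ℝ ∞ u U ∧ ∀ φ : TestFn d, tsupport φ ⊆ U → T φ = ∫ x, φ x • u x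

/-- `T` vanishes to infinite order at `x₀`: near `x₀` it is given by a smooth function `u` with
`∂_{m 0} ⋯ ∂_{m (n - 1)} u (x₀) = 0` for all `n ≥ 0` and all sequences `m` of coordinates. -/
def VanishesToInfiniteOrderAt {d : ℕ} (T : TestFn d → ℂ) (x₀ : Rd d) : Prop :=
  ∃ (U : Set (Rd d)) (u : Rd d → ℂ), IsOpen U ∧ x₀ ∈ U ∧ IsGivenOnBy T U u ∧
    ∀ (n : ℕ) (m : Fin n → Fin d),
      iteratedFDeriv ℝ n u x₀ (fun i => EuclideanSpace.single (m i) (1 : ℝ)) = 0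

/-!
Let `S` be the support of `f`. Off `S`, both operators are given by potentials `x ↦ ⟨f, h (x - ·)⟩`
whose kernel `h` is a multiple of `|z|^{2s}`, with `2s = -α` for the Riesz potential and, by polar
coordinates, `2s = 1 - d` for the normal operator (`xrayAdjoint_xray_eq`). Such a potential is
smooth off `S`, and differentiating it amounts to differentiating the kernel
(`Distn.fderiv_potential`). Hence the kernels whose potential vanishes to infinite order at `x₀`
(`Distn.IsFlatKernel`) are closed under linear combinations and directional derivatives.

If `|z|^{2s}` is such a kernel, then taking Laplacians shows that all `|z|^{2s - 2k}` are, because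
`Δ |z|^{2s} = 2s (2s + d - 2) |z|^{2s - 2}` and the assumption on `α` keeps the factors away
from `0`. Further derivatives along `v` show that all `(v · z)^n |z|^{2s - 2k - 2n}` are
(`Distn.IsFlatKernel.polyKernel_sub`). Evaluating the potentials at `x₀`, with `k = 0`, yields
`⟨f, |y - x₀|^{2s} (v · w)^n⟩ = 0` for all `v` and `n`, where `w = (y - x₀) / |y - x₀|²`. So the
push-forward of `|y - x₀|^{2s} f` under the inversion, which has compact support since `x₀ ∉ S`,
annihilates all polynomials. Its regularizations are continuous functions with compact support whose
moments vanish, so their Fourier transforms vanish, and the push-forward is zero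
(`Distn.pairing_mul_comp_eq_zero`). Undoing the inversion gives `f = 0`
(`Distn.eq_zero_of_isFlatKernel`).

The calculus with distributions rests on `Distn.exists_finite_order`: on a compact set, `f` is a
continuous linear functional of finitely many derivatives in Banach spaces of continuous functions.
This makes `x ↦ ⟨f, G (x, ·)⟩` smooth for smooth `G`, and `f` commute with derivatives and
integrals in the parameter `x`.
-/

/-! ### Smooth functions of two variables -/

section TwoVariables

set_option linter.unusedSectionVars false

universe u

variable {P E F : Type u} [NormedAddCommGroup P] [NormedSpace ℝ P]
  [NormedAddCommGroup E] [NormedSpace ℝ E] [NormedAddCommGroup F] [NormedSpace ℝ F]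

/-- The function `y ↦ G (x, y)` on the compact set `K`, as a point of the Banach space `C(K, F)`
depending on the parameter `x`. -/
def sectionOn (K : Compacts E) (G : P × E → F) (hG : Continuous G) (x : P) : C(K, F) where
  toFun y := G (x, y)
  continuous_toFun := hG.comp (continuous_const.prodMk continuous_subtype_val)

@[simp]
theorem sectionOn_apply (K : Compacts E) (G : P × E → F) (hG : Continuous G) (x : P) (y : K) :
    sectionOn K G hG x y = G (x, y) := rfl

theorem continuous_sectionOn (K : Compacts E) (G : P × E → F) (hG : Continuous G) :
    Continuous (sectionOn K G hG) := by
  refine ContinuousMap.continuous_of_continuous_uncurry _ ?_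
  exact hG.comp (continuous_fst.prodMk (continuous_subtype_val.comp continuous_snd))

/-- A continuous family of linear maps indexed by `K` acts pointwise as a linear map into
`C(K, F)`. -/
noncomputable def pointwiseApply (K : Compacts E) : C(K, P →L[ℝ] F) →L[ℝ] P →L[ℝ] C(K, F) :=
  LinearMap.mkContinuous₂
    (LinearMap.mk₂ ℝ
      (fun (A : C(K, P →L[ℝ] F)) (v : P) => (⟨fun y => A y v, by fun_prop⟩ : C(K, F)))
      (fun A B v => by ext y; simp) (fun c A v => by ext y; simp) (fun A v w => by ext y; simp)
      (fun c A v => by ext y; simp)) 1 (by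
    intro A v
    rw [one_mul, ContinuousMap.norm_le _ (by positivity)]
    intro y
    exact ((A y).le_opNorm v).trans (by gcongr; exact A.norm_coe_le_norm y))

/-- The partial derivative of `G` with respect to the first variable. -/
noncomputable def fderivFst (G : P × E → F) (p : P × E) : P →L[ℝ] F :=
  (fderiv ℝ G p).comp (ContinuousLinearMap.inl ℝ P E)

/-- The partial derivative of `G` with respect to the second variable. -/
noncomputable def fderivSnd (G : P × E → F) (p : P × E) : E →L[ℝ] F :=
  (fderiv ℝ G p).comp (ContinuousLinearMap.inr ℝ P E)

theorem ContDiff.fderivFst {G : P × E → F} (hG : ContDiff ℝ ∞ G) :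
    ContDiff ℝ ∞ (fderivFst G) :=
  (hG.fderiv_right (m := ∞) (by simp)).clm_comp contDiff_const

theorem ContDiff.fderivSnd {G : P × E → F} (hG : ContDiff ℝ ∞ G) :
    ContDiff ℝ ∞ (fderivSnd G) :=
  (hG.fderiv_right (m := ∞) (by simp)).clm_comp contDiff_const

theorem hasFDerivAt_partialFst {G : P × E → F} (hG : ContDiff ℝ ∞ G) (x : P) (y : E) :
    HasFDerivAt (fun x => G (x, y)) (fderivFst G (x, y)) x :=
  ((hG.differentiable (by simp)).differentiableAt.hasFDerivAt (x := (x, y))).comp x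
    (hasFDerivAt_prodMk_left x y)

theorem hasFDerivAt_partialSnd {G : P × E → F} (hG : ContDiff ℝ ∞ G) (x : P) (y : E) :
    HasFDerivAt (fun y => G (x, y)) (fderivSnd G (x, y)) y :=
  ((hG.differentiable (by simp)).differentiableAt.hasFDerivAt (x := (x, y))).comp y
    (hasFDerivAt_prodMk_right x y)

/-- The difference quotients converge uniformly on `K`, by the mean value inequality and the
continuity of `x ↦ ∂₁ G (x, ·)` with values in `C(K, P →L[ℝ] F)`. -/
theorem hasFDerivAt_sectionOn (K : Compacts E) {G : P × E → F} (hG : ContDiff ℝ ∞ G) (x : P) :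
    HasFDerivAt (sectionOn K G hG.continuous)
      (pointwiseApply K (sectionOn K (fderivFst G) hG.fderivFst.continuous x)) x := by
  rw [hasFDerivAt_iff_isLittleO, Asymptotics.isLittleO_iff]
  intro ε hε
  have hc := (continuous_sectionOn K (fderivFst G) hG.fderivFst.continuous).tendsto x
  obtain ⟨δ, hδ, hball⟩ := Metric.eventually_nhds_iff_ball.1
    (hc.eventually (Metric.closedBall_mem_nhds _ hε))
  filter_upwards [Metric.ball_mem_nhds x hδ] with x' hx'
  rw [ContinuousMap.norm_le _ (by positivity)]
  intro y
  refine (convex_ball x δ).norm_image_sub_le_of_norm_hasFDerivWithin_le'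
    (f := fun x => G (x, y)) (f' := fun z => fderivFst G (z, y))
    (φ := fderivFst G (x, y)) (fun z _ => (hasFDerivAt_partialFst hG z y).hasFDerivWithinAt)
    (fun z hz => ?_) (Metric.mem_ball_self hδ) hx'
  have h1 := hball z hz
  rw [dist_eq_norm] at h1
  exact ((sectionOn K (fderivFst G) hG.fderivFst.continuous z
    - sectionOn K (fderivFst G) hG.fderivFst.continuous x).norm_coe_le_norm y).trans h1

theorem contDiff_sectionOn (K : Compacts E) {G : P × E → F} (hG : ContDiff ℝ ∞ G) :
    ContDiff ℝ ∞ (sectionOn K G hG.continuous) := by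
  refine contDiff_infty.2 fun n => ?_
  induction n generalizing F with
  | zero => exact contDiff_zero.2 (continuous_sectionOn K G hG.continuous)
  | succ n ih =>
    rw [Nat.cast_succ, contDiff_succ_iff_hasFDerivAt]
    exact ⟨fun x => pointwiseApply K (sectionOn K (fderivFst G) hG.fderivFst.continuous x),
      ContDiff.comp (g := pointwiseApply (P := P) (F := F) K) (ContinuousLinearMap.contDiff _)
        (ih hG.fderivFst),
      fun x => hasFDerivAt_sectionOn K hG x⟩

/-- Iterated derivatives with respect to the second variable. -/
noncomputable def iteratedFDerivSnd (i : ℕ) (G : P × E → F) (p : P × E) : E [×i]→L[ℝ] F :=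
  iteratedFDeriv ℝ i (fun y => G (p.1, y)) p.2

theorem iteratedFDerivSnd_zero (G : P × E → F) :
    iteratedFDerivSnd 0 G = (continuousMultilinearCurryFin0 ℝ E F).symm ∘ G := by
  ext p m
  simp [iteratedFDerivSnd]

theorem iteratedFDerivSnd_succ {i : ℕ} {G : P × E → F}
    (hG : ContDiff ℝ ∞ (iteratedFDerivSnd i G)) :
    iteratedFDerivSnd (i + 1) G =
      (continuousMultilinearCurryLeftEquiv ℝ (fun _ : Fin (i + 1) => E) F).symm ∘
        fderivSnd (iteratedFDerivSnd i G) := by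
  ext1 p
  rw [iteratedFDerivSnd, iteratedFDeriv_succ_eq_comp_left]
  simp only [Function.comp_apply]
  congr 1
  exact (hasFDerivAt_partialSnd hG p.1 p.2).fderiv

theorem ContDiff.iteratedFDerivSnd {G : P × E → F} (hG : ContDiff ℝ ∞ G) (i : ℕ) :
    ContDiff ℝ ∞ (iteratedFDerivSnd i G) := by
  induction i with
  | zero =>
    rw [iteratedFDerivSnd_zero]
    exact (LinearIsometryEquiv.contDiff _).comp hG
  | succ i ih =>
    rw [iteratedFDerivSnd_succ ih]
    exact (LinearIsometryEquiv.contDiff _).comp ih.fderivSnd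

/-- Partial derivatives in different variables commute. -/
theorem fderivFst_fderivSnd_comm {G : P × E → F} (hG : ContDiff ℝ ∞ G) (p : P × E) (v : P)
    (w : E) : fderivFst (fderivSnd G) p v w = fderivSnd (fun q => fderivFst G q v) p w := by
  have hd : DifferentiableAt ℝ (fderiv ℝ G) p :=
    ((hG.fderiv_right (m := ∞) (by simp)).differentiable (by simp)).differentiableAt
  have h1 : fderiv ℝ (fderivSnd G) p (v, 0) = (fderiv ℝ (fderiv ℝ G) p (v, 0)).comp
      (ContinuousLinearMap.inr ℝ P E) := by
    have := (((ContinuousLinearMap.compL ℝ E (P × E) F).flip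
      (ContinuousLinearMap.inr ℝ P E)).hasFDerivAt.comp p hd.hasFDerivAt).fderiv
    exact congrArg (fun A => A (v, 0)) this
  have h2 : fderiv ℝ (fun q => fderivFst G q v) p (0, w) =
      fderiv ℝ (fderiv ℝ G) p (0, w) (v, 0) := by
    have := ((ContinuousLinearMap.apply ℝ F ((v, 0) : P × E)).hasFDerivAt.comp p
      hd.hasFDerivAt).fderiv
    exact congrArg (fun A => A (0, w)) this
  have hs : IsSymmSndFDerivAt ℝ G p :=
    hG.contDiffAt.isSymmSndFDerivAt (by
      simpa using (mod_cast le_top : ((2 : ℕ∞) : WithTop ℕ∞) ≤ ((⊤ : ℕ∞) : WithTop ℕ∞)))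
  have h3 : fderivFst (fderivSnd G) p v w = fderiv ℝ (fderivSnd G) p (v, 0) w := rfl
  have h4 : fderivSnd (fun q => fderivFst G q v) p w
      = fderiv ℝ (fun q => fderivFst G q v) p (0, w) := rfl
  rw [h3, h4, h1, h2]
  exact hs _ _

theorem fderivFst_iteratedFDerivSnd_comm {G : P × E → F} (hG : ContDiff ℝ ∞ G) (i : ℕ) (v : P)
    (p : P × E) :
    fderivFst (iteratedFDerivSnd i G) p v =
      iteratedFDerivSnd i (fun q => fderivFst G q v) p := by
  have hGv : ContDiff ℝ ∞ fun q => fderivFst G q v := hG.fderivFst.clm_apply contDiff_const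
  induction i generalizing p with
  | zero =>
    rw [iteratedFDerivSnd_zero, iteratedFDerivSnd_zero]
    have := ((continuousMultilinearCurryFin0 ℝ E F).symm.toContinuousLinearEquiv.hasFDerivAt.comp p
      (hG.differentiable (by simp)).differentiableAt.hasFDerivAt).fderiv
    exact congrArg (fun A => A (v, 0)) this
  | succ i ih =>
    have hi := hG.iteratedFDerivSnd i
    rw [iteratedFDerivSnd_succ hi, iteratedFDerivSnd_succ (hGv.iteratedFDerivSnd i)]
    have := ((continuousMultilinearCurryLeftEquiv ℝ
      (fun _ : Fin (i + 1) => E) F).symm.toContinuousLinearEquiv.hasFDerivAt.comp p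
      (hi.fderivSnd.differentiable (by simp)).differentiableAt.hasFDerivAt).fderiv
    refine (congrArg (fun A => A (v, 0)) this).trans ?_
    refine congrArg (continuousMultilinearCurryLeftEquiv ℝ
      (fun _ : Fin (i + 1) => E) F).symm ?_
    ext1 w
    refine (fderivFst_fderivSnd_comm hi p v w).trans ?_
    rw [show (fun q => fderivFst (iteratedFDerivSnd i G) q v)
      = iteratedFDerivSnd i fun q => fderivFst G q v from funext ih]

variable [MeasurableSpace P] [BorelSpace P] [SecondCountableTopology P] [ProperSpace E]
  {μ : Measure P} [IsFiniteMeasureOnCompacts μ] {L : Set P}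

theorem hasFDerivAt_setIntegral {G : P × E → F} (hG : ContDiff ℝ ∞ G) (hL : IsCompact L) (y : E) :
    HasFDerivAt (fun y => ∫ x in L, G (x, y) ∂μ) (∫ x in L, fderivSnd G (x, y) ∂μ) y := by
  have hcont : ∀ {X : Type u} [NormedAddCommGroup X] {H : P × E → X}, Continuous H → ∀ y,
      IntegrableOn (fun x => H (x, y)) L μ := fun hH y =>
    (hH.comp (continuous_id.prodMk continuous_const)).continuousOn.integrableOn_compact hL
  obtain ⟨C, hC⟩ := (hL.prod (isCompact_closedBall y 1)).exists_bound_of_continuousOn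
    hG.fderivSnd.continuous.continuousOn
  refine hasFDerivAt_integral_of_dominated_of_fderiv_le (bound := fun _ => C)
    (F' := fun y x => fderivSnd G (x, y)) (Metric.closedBall_mem_nhds y one_pos)
    (Eventually.of_forall fun z => (hcont hG.continuous z).aestronglyMeasurable)
    (hcont hG.continuous y) (hcont hG.fderivSnd.continuous y).aestronglyMeasurable ?_ ?_ ?_
  · filter_upwards [ae_restrict_mem hL.measurableSet] with x hx z hz
    exact hC (x, z) ⟨hx, hz⟩
  · exact integrableOn_const hL.measure_lt_top.ne
  · exact Eventually.of_forall fun x z _ => hasFDerivAt_partialSnd hG x z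

theorem contDiff_setIntegral {G : P × E → F} (hG : ContDiff ℝ ∞ G) (hL : IsCompact L) :
    ContDiff ℝ ∞ fun y => ∫ x in L, G (x, y) ∂μ := by
  refine contDiff_infty.2 fun n => ?_
  induction n generalizing F with
  | zero => exact contDiff_zero.2 (continuous_iff_continuousAt.2 fun y =>
      (hasFDerivAt_setIntegral hG hL y).continuousAt)
  | succ n ih =>
    rw [Nat.cast_succ, contDiff_succ_iff_hasFDerivAt]
    exact ⟨_, ih hG.fderivSnd, fun y => hasFDerivAt_setIntegral hG hL y⟩

theorem iteratedFDeriv_setIntegral [CompleteSpace F] {G : P × E → F} (hG : ContDiff ℝ ∞ G)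
    (hL : IsCompact L) (i : ℕ) (y : E) :
    iteratedFDeriv ℝ i (fun y => ∫ x in L, G (x, y) ∂μ) y =
      ∫ x in L, iteratedFDerivSnd i G (x, y) ∂μ := by
  induction i generalizing y with
  | zero =>
    rw [iteratedFDeriv_zero_eq_comp, iteratedFDerivSnd_zero]
    exact ((continuousMultilinearCurryFin0 ℝ E F).symm.toContinuousLinearEquiv.integral_comp_comm
      _).symm
  | succ i ih =>
    have hi := hG.iteratedFDerivSnd i
    rw [iteratedFDeriv_succ_eq_comp_left, iteratedFDerivSnd_succ hi, Function.comp_apply,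
      funext ih, (hasFDerivAt_setIntegral hi hL y).fderiv]
    have hintg : IntegrableOn (fun x => fderivSnd (iteratedFDerivSnd i G) (x, y)) L μ :=
      (hi.fderivSnd.continuous.comp
        (continuous_id.prodMk continuous_const)).continuousOn.integrableOn_compact hL
    exact (ContinuousLinearMap.integral_comp_comm
      ((continuousMultilinearCurryLeftEquiv ℝ
        (fun _ : Fin (i + 1) => E) F).symm.toContinuousLinearEquiv :
          (E →L[ℝ] E [×i]→L[ℝ] F) →L[ℝ] (E [×(i + 1)]→L[ℝ] F)) hintg).symm

end TwoVariables

/-! ### Pairing a compactly supported distribution with a family of smooth functions -/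

/-- The `i`-th derivative of a smooth function on a compact set. -/
noncomputable def jetOn {E : Type*} [NormedAddCommGroup E] [NormedSpace ℝ E] (K : Compacts E)
    (i : ℕ) (ψ : E → ℝ) (hψ : ContDiff ℝ ∞ ψ) : C(K, E [×i]→L[ℝ] ℝ) where
  toFun y := iteratedFDeriv ℝ i ψ y
  continuous_toFun := (hψ.continuous_iteratedFDeriv (mod_cast le_top)).comp continuous_subtype_val

theorem jetOn_apply {E : Type*} [NormedAddCommGroup E] [NormedSpace ℝ E] (K : Compacts E)
    (i : ℕ) (ψ : E → ℝ) (hψ : ContDiff ℝ ∞ ψ) (y : K) :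
    jetOn K i ψ hψ y = iteratedFDeriv ℝ i ψ y := rfl

/-- A consequence of the Hahn-Banach theorem: a linear map that is bounded in terms of an injective
linear map `J` into a normed space factors through `J`. -/
theorem exists_extension_of_norm_le {V W : Type*} [AddCommGroup V] [Module ℝ V]
    [NormedAddCommGroup W] [NormedSpace ℝ W] (J : V →ₗ[ℝ] W) (hJ : Function.Injective J)
    (ℓ : V →ₗ[ℝ] ℂ) (C : ℝ) (hℓ : ∀ v, ‖ℓ v‖ ≤ C * ‖J v‖) :
    ∃ G : W →L[ℝ] ℂ, ∀ v, ℓ v = G (J v) := by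
  let e := LinearEquiv.ofInjective J hJ
  let g : LinearMap.range J →L[ℝ] ℂ := LinearMap.mkContinuous (ℓ.comp e.symm.toLinearMap) C (by
    intro z
    obtain ⟨v, rfl⟩ := e.surjective z
    rw [LinearMap.comp_apply, LinearEquiv.coe_coe, e.symm_apply_apply]
    exact hℓ v)
  obtain ⟨G, hG⟩ := g.exist_extension_of_finiteDimensional_range
  refine ⟨G, fun v => ?_⟩
  have h1 : g (e v) = ℓ v := congrArg ℓ (e.symm_apply_apply v)
  rw [← h1, hG]
  rfl

namespace Distn

variable {d : ℕ}

/-- A distribution has finite order on a compact set `K`: by the Hahn-Banach theorem, it is a finite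
sum of continuous functionals of the derivatives in the Banach spaces of continuous functions
on `K`. -/
theorem exists_finite_order (f : Distn d) (K : Compacts (Rd d)) :
    ∃ (n : ℕ) (F : ∀ i : Fin n, C(K, Rd d [×(i : ℕ)]→L[ℝ] ℝ) →L[ℝ] ℂ),
      ∀ φ : TestFn d, tsupport φ ⊆ K → f φ = ∑ i, F i (jetOn K i φ φ.contDiff) := by
  let fK : 𝓓_{K}(Rd d, ℝ) →L[ℝ] ℂ :=
    f.comp (TestFunction.ofSupportedInCLM ℝ (Ω := (⊤ : Opens (Rd d))) (subset_univ _))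
  have hq : Continuous ((normSeminorm ℝ ℂ).comp fK.toLinearMap) :=
    continuous_norm.comp fK.continuous
  obtain ⟨s, C, -, hC⟩ := Seminorm.bound_of_continuous
    (ContDiffMapSupportedIn.withSeminorms ℝ (Rd d) ℝ ⊤ K) _ hq
  obtain ⟨n, hn⟩ := (insert 0 s).exists_nat_subset_range
  let J : 𝓓_{K}(Rd d, ℝ) →ₗ[ℝ] (∀ i : Fin n, C(K, Rd d [×(i : ℕ)]→L[ℝ] ℝ)) :=
    { toFun := fun φ i => jetOn K i φ φ.contDiff
      map_add' := fun φ ψ => by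
        ext i y m
        simp only [jetOn_apply, Pi.add_apply, ContinuousMap.add_apply]
        rw [FunLike.coe_add, iteratedFDeriv_add_apply
          (φ.contDiff.of_le (mod_cast le_top)).contDiffAt
          (ψ.contDiff.of_le (mod_cast le_top)).contDiffAt]
      map_smul' := fun c φ => by
        ext i y m
        simp only [jetOn_apply, Pi.smul_apply, ContinuousMap.smul_apply, RingHom.id_apply]
        rw [FunLike.coe_smul, iteratedFDeriv_const_smul_apply
          (φ.contDiff.of_le (mod_cast le_top)).contDiffAt] }
  have hJ : ∀ φ i, J φ i = jetOn K i φ φ.contDiff := fun _ _ => rfl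
  have hn0 : 0 < n := Finset.mem_range.1 (hn (Finset.mem_insert_self 0 s))
  have hinj : Function.Injective J := by
    intro φ ψ h
    ext y
    by_cases hy : y ∈ K
    · have := congrArg (fun A => A ⟨y, hy⟩ 0) (congrFun h ⟨0, hn0⟩)
      simpa [hJ, jetOn_apply] using this
    · rw [φ.zero_on_compl hy, ψ.zero_on_compl hy]
  have hbound : ∀ φ, ‖fK φ‖ ≤ C * ‖J φ‖ := by
    intro φ
    refine (hC φ).trans ?_
    change (C : ℝ) * _ ≤ _
    refine mul_le_mul_of_nonneg_left ?_ C.2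
    refine Seminorm.finset_sup_apply_le (norm_nonneg _) fun i hi => ?_
    rw [ContDiffMapSupportedIn.seminorm_top_le_iff ℝ (norm_nonneg _)]
    intro x hx
    have hin : i < n := Finset.mem_range.1 (hn (Finset.mem_insert_of_mem hi))
    exact ((J φ ⟨i, hin⟩).norm_coe_le_norm ⟨x, hx⟩).trans (norm_le_pi_norm (J φ) ⟨i, hin⟩)
  obtain ⟨G, hG⟩ := exists_extension_of_norm_le
    (W := ∀ i : Fin n, C(K, Rd d [×(i : ℕ)]→L[ℝ] ℝ)) J hinj
    fK.toLinearMap C hbound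
  refine ⟨n, fun i => G.comp (ContinuousLinearMap.single ℝ
    (fun i : Fin n => C(K, Rd d [×(i : ℕ)]→L[ℝ] ℝ)) i), fun φ hφ => ?_⟩
  let φK : 𝓓_{K}(Rd d, ℝ) := ⟨φ, φ.contDiff, fun x hx =>
    image_eq_zero_of_notMem_tsupport fun h => hx (hφ h)⟩
  have h1 : f φ = fK φK := rfl
  have h2 : fK φK = G (J φK) := hG φK
  rw [h1, h2, ← Finset.univ_sum_single (J φK), map_sum]
  rfl

variable {f : Distn d}

theorem pairing_congr {ψ ψ' : Rd d → ℝ} (h : ∀ᶠ x in 𝓝ˢ (Distribution.dsupport f), ψ x = ψ' x) :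
    f.pairing ψ = f.pairing ψ' := by
  by_cases hψ : ∃ φ : TestFn d, ∀ᶠ x in 𝓝ˢ (Distribution.dsupport f), φ x = ψ x
  · obtain ⟨φ, hφ⟩ := hψ
    rw [pairing_eq f ψ φ hφ, pairing_eq f ψ' φ (by
      filter_upwards [hφ, h] with x h1 h2 using h1.trans h2)]
  · have hψ' : ¬ ∃ φ : TestFn d, ∀ᶠ x in 𝓝ˢ (Distribution.dsupport f), φ x = ψ' x := by
      rintro ⟨φ, hφ⟩
      exact hψ ⟨φ, by filter_upwards [hφ, h] with x h1 h2 using h1.trans h2.symm⟩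
    rw [pairing, pairing, dif_neg hψ, dif_neg hψ']

variable (hf : IsCompact (Distribution.dsupport f))
include hf

/-- A cutoff function that is `1` near the support. -/
theorem exists_cutoff : ∃ χ : TestFn d, ∀ᶠ x in 𝓝ˢ (Distribution.dsupport f), χ x = 1 :=
  exists_test_eventuallyEq f hf (fun _ => 1) contDiff_const

/-- The pairing with smooth functions is a finite sum of continuous functionals of the derivatives
of `χ ψ` on a compact set, where the cutoff `χ` is `1` near the support. -/
theorem exists_pairing_eq_sum :
    ∃ (χ : TestFn d) (K : Compacts (Rd d)) (n : ℕ)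
      (F : ∀ i : Fin n, C(K, Rd d [×(i : ℕ)]→L[ℝ] ℝ) →L[ℝ] ℂ),
      ∀ (ψ : Rd d → ℝ) (hψ : ContDiff ℝ ∞ ψ),
        f.pairing ψ = ∑ i, F i (jetOn K i (fun y => χ y * ψ y) (χ.contDiff.mul hψ)) := by
  obtain ⟨χ, hχ⟩ := exists_cutoff hf
  let K : Compacts (Rd d) := ⟨tsupport χ, χ.hasCompactSupport⟩
  obtain ⟨n, F, hF⟩ := f.exists_finite_order K
  refine ⟨χ, K, n, F, fun ψ hψ => ?_⟩
  let φ : TestFn d := ⟨fun y => χ y * ψ y, χ.contDiff.mul hψ, χ.hasCompactSupport.mul_right,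
    subset_univ _⟩
  rw [pairing_eq f ψ φ (by
    filter_upwards [hχ] with x hx
    change χ x * ψ x = ψ x
    rw [hx, one_mul])]
  exact hF φ (tsupport_mul_subset_left (f := χ) (g := ψ))

theorem pairing_add {ψ₁ ψ₂ : Rd d → ℝ} (h₁ : ContDiff ℝ ∞ ψ₁) (h₂ : ContDiff ℝ ∞ ψ₂) :
    f.pairing (fun y => ψ₁ y + ψ₂ y) = f.pairing ψ₁ + f.pairing ψ₂ := by
  obtain ⟨φ₁, hφ₁⟩ := exists_test_eventuallyEq f hf ψ₁ h₁
  obtain ⟨φ₂, hφ₂⟩ := exists_test_eventuallyEq f hf ψ₂ h₂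
  rw [pairing_eq f ψ₁ φ₁ hφ₁, pairing_eq f ψ₂ φ₂ hφ₂, ← map_add]
  refine pairing_eq f _ _ ?_
  filter_upwards [hφ₁, hφ₂] with x h1 h2
  change φ₁ x + φ₂ x = _
  rw [h1, h2]

theorem pairing_const_mul {ψ : Rd d → ℝ} (hψ : ContDiff ℝ ∞ ψ) (c : ℝ) :
    f.pairing (fun y => c * ψ y) = c * f.pairing ψ := by
  obtain ⟨φ, hφ⟩ := exists_test_eventuallyEq f hf ψ hψ
  rw [pairing_eq f ψ φ hφ, ← Complex.real_smul, ← map_smul]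
  refine pairing_eq f _ _ ?_
  filter_upwards [hφ] with x h1
  change c * φ x = _
  rw [h1]

theorem pairing_sum {ι : Type*} (s : Finset ι) {ψ : ι → Rd d → ℝ}
    (hψ : ∀ i ∈ s, ContDiff ℝ ∞ (ψ i)) :
    f.pairing (fun y => ∑ i ∈ s, ψ i y) = ∑ i ∈ s, f.pairing (ψ i) := by
  classical
  induction s using Finset.induction_on with
  | empty =>
    simp only [Finset.sum_empty]
    have := pairing_const_mul hf (contDiff_const (c := (0 : ℝ))) 0
    simpa using this
  | insert i s hi ih =>
    simp only [Finset.sum_insert hi]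
    rw [pairing_add hf (hψ i (Finset.mem_insert_self i s))
      (ContDiff.sum fun j hj => hψ j (Finset.mem_insert_of_mem hj)),
      ih fun j hj => hψ j (Finset.mem_insert_of_mem hj)]

section Families

variable {P : Type} [NormedAddCommGroup P] [NormedSpace ℝ P] {G : P × Rd d → ℝ}

omit hf in
theorem contDiff_section (hG : ContDiff ℝ ∞ G) (x : P) : ContDiff ℝ ∞ fun y => G (x, y) :=
  hG.comp (contDiff_const.prodMk contDiff_id)

omit hf in
theorem contDiff_cutoff_mul (hG : ContDiff ℝ ∞ G) (χ : TestFn d) :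
    ContDiff ℝ ∞ fun p : P × Rd d => χ p.2 * G p :=
  (χ.contDiff.comp contDiff_snd).mul hG

theorem contDiff_pairing_and_fderiv_pairing (hG : ContDiff ℝ ∞ G) :
    ContDiff ℝ ∞ (fun x => f.pairing fun y => G (x, y)) ∧
      ∀ x v, fderiv ℝ (fun x => f.pairing fun y => G (x, y)) x v =
        f.pairing fun y => fderivFst G (x, y) v := by
  obtain ⟨χ, K, n, F, hF⟩ := exists_pairing_eq_sum hf
  have hχG := contDiff_cutoff_mul hG χ
  have hGv : ∀ v, ContDiff ℝ ∞ fun p => fderivFst G p v := fun v =>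
    hG.fderivFst.clm_apply contDiff_const
  have hi : ∀ i : ℕ, ContDiff ℝ ∞ (iteratedFDerivSnd i fun p : P × Rd d => χ p.2 * G p) :=
    hχG.iteratedFDerivSnd
  have hfun : (fun x => f.pairing fun y => G (x, y)) =
      fun x => ∑ i, F i (sectionOn K _ (hi i).continuous x) :=
    funext fun x => hF _ (contDiff_section hG x)
  have hsm : ∀ i, ContDiff ℝ ∞ fun x => F i (sectionOn K _ (hi i).continuous x) := fun i =>
    ContDiff.comp (g := F i) (ContinuousLinearMap.contDiff _) (contDiff_sectionOn K (hi i))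
  rw [hfun]
  refine ⟨ContDiff.sum fun i _ => hsm i, fun x v => ?_⟩
  rw [fderiv_fun_sum fun i _ => ((hsm i).differentiable (by simp)).differentiableAt,
    hF _ (contDiff_section (hGv v) x), sum_apply]
  refine Finset.sum_congr rfl fun i _ => ?_
  have h1 := ((F i).hasFDerivAt.comp x (hasFDerivAt_sectionOn K (hi i) x)).fderiv
  refine (congrArg (fun A => A v) h1).trans ?_
  refine congrArg (F i) ?_
  ext1 y
  refine (fderivFst_iteratedFDerivSnd_comm hχG i v (x, (y : Rd d))).trans ?_
  rw [jetOn_apply, iteratedFDerivSnd]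
  congr 1
  ext1 z
  have h2 := ((hasFDerivAt_partialFst hG x z).const_mul (χ z)).unique
    (hasFDerivAt_partialFst hχG x z)
  rw [← h2]
  rfl

theorem contDiff_pairing (hG : ContDiff ℝ ∞ G) :
    ContDiff ℝ ∞ fun x => f.pairing fun y => G (x, y) :=
  (contDiff_pairing_and_fderiv_pairing hf hG).1

theorem fderiv_pairing (hG : ContDiff ℝ ∞ G) (x v : P) :
    fderiv ℝ (fun x => f.pairing fun y => G (x, y)) x v =
      f.pairing fun y => fderivFst G (x, y) v :=
  (contDiff_pairing_and_fderiv_pairing hf hG).2 x v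

/-- A distribution commutes with integration over a parameter. -/
theorem setIntegral_pairing [MeasurableSpace P] [BorelSpace P] [SecondCountableTopology P]
    {μ : Measure P} [IsFiniteMeasureOnCompacts μ] {L : Set P} (hG : ContDiff ℝ ∞ G)
    (hL : IsCompact L) :
    ∫ x in L, f.pairing (fun y => G (x, y)) ∂μ = f.pairing fun y => ∫ x in L, G (x, y) ∂μ := by
  obtain ⟨χ, K, n, F, hF⟩ := exists_pairing_eq_sum hf
  have hχG := contDiff_cutoff_mul hG χ
  have hi : ∀ i : ℕ, ContDiff ℝ ∞ (iteratedFDerivSnd i fun p : P × Rd d => χ p.2 * G p) :=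
    hχG.iteratedFDerivSnd
  have hfun : (fun x => f.pairing fun y => G (x, y)) =
      fun x => ∑ i, F i (sectionOn K _ (hi i).continuous x) :=
    funext fun x => hF _ (contDiff_section hG x)
  have hintg : ∀ i : ℕ, IntegrableOn (sectionOn K _ (hi i).continuous) L μ := fun i =>
    (continuous_sectionOn K _ (hi i).continuous).continuousOn.integrableOn_compact hL
  rw [hfun, integral_finsetSum _ fun i _ => (F i).integrable_comp (hintg i),
    hF _ (contDiff_setIntegral hG hL)]
  refine Finset.sum_congr rfl fun i _ => ?_
  rw [ContinuousLinearMap.integral_comp_comm _ (hintg i)]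
  congr 1
  ext1 y
  rw [ContinuousMap.integral_apply (hintg i), jetOn_apply]
  simp only [sectionOn_apply]
  rw [← iteratedFDeriv_setIntegral hχG hL]
  congr 1
  ext1 z
  exact (integral_const_mul (μ := μ.restrict L) (χ z) fun x => G (x, z))

end Families

end Distn

/-! ### Distributions that annihilate polynomials -/

section Moments

open scoped FourierTransform RealInnerProductSpace

variable {E : Type*} [NormedAddCommGroup E] [InnerProductSpace ℝ E] [FiniteDimensional ℝ E]
  [MeasurableSpace E] [BorelSpace E]

/-- A continuous function with compact support whose moments all vanish is zero, because its Fourier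
transform is the sum of a power series whose coefficients are the moments. -/
theorem eq_zero_of_moments_eq_zero {h : E → ℂ} (hc : Continuous h) (hs : HasCompactSupport h)
    (hm : ∀ (v : E) (n : ℕ), ∫ x, ((⟪v, x⟫ ^ n : ℝ) : ℂ) * h x = 0) : h = 0 := by
  have hi : Integrable h := hc.integrable_of_hasCompactSupport hs
  obtain ⟨R, hR⟩ := hs.isCompact.isBounded.exists_norm_le
  have hF : 𝓕 h = 0 := by
    ext v
    rw [Real.fourier_eq', Pi.zero_apply]
    set c : ℂ := -2 * Real.pi * Complex.I
    have hsum : HasSum (fun n : ℕ => ∫ x, (c * (⟪v, x⟫ : ℝ)) ^ n / n.factorial * h x)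
        (∫ x, Complex.exp (c * (⟪v, x⟫ : ℝ)) * h x) := by
      refine hasSum_integral_of_dominated_convergence
        (fun n x => (‖c‖ * (‖v‖ * R)) ^ n / n.factorial * ‖h x‖) (fun n => ?_) (fun n => ?_)
        ?_ ?_ ?_
      · exact Continuous.aestronglyMeasurable (by fun_prop)
      · refine Eventually.of_forall fun x => ?_
        by_cases hx : x ∈ tsupport h
        · rw [norm_mul, norm_div, norm_pow, norm_mul, Complex.norm_real, Complex.norm_natCast]
          have : ‖(⟪v, x⟫ : ℝ)‖ ≤ ‖v‖ * R :=
            (norm_inner_le_norm v x).trans (by gcongr; exact hR x hx)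
          gcongr
        · simp [image_eq_zero_of_notMem_tsupport hx]
      · exact Eventually.of_forall fun x => (Real.summable_pow_div_factorial _).mul_right _
      · simp_rw [tsum_mul_right]
        exact hi.norm.const_mul _
      · refine Eventually.of_forall fun x => HasSum.mul_right _ ?_
        rw [Complex.exp_eq_exp_ℂ]
        exact NormedSpace.expSeries_div_hasSum_exp _
    have hzero : ∀ n : ℕ, ∫ x, (c * (⟪v, x⟫ : ℝ)) ^ n / n.factorial * h x = 0 := by
      intro n
      have : ∀ x, (c * (⟪v, x⟫ : ℝ)) ^ n / n.factorial * h x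
          = (c ^ n / n.factorial) * (((⟪v, x⟫ ^ n : ℝ) : ℂ) * h x) := by
        intro x
        push_cast
        ring
      simp_rw [this]
      rw [integral_const_mul, hm, mul_zero]
    simp_rw [hzero] at hsum
    rw [← hsum.unique hasSum_zero]
    refine integral_congr_ae (Eventually.of_forall fun x => ?_)
    simp only [smul_eq_mul, c]
    rw [real_inner_comm]
    push_cast
    congr 2
    ring
  have := hc.fourierInv_fourier_eq hi (by rw [hF]; exact integrable_zero _ _ _)
  rw [← this, hF]
  ext x
  simp [Real.fourierInv_eq]

end Moments

namespace Distn

open scoped RealInnerProductSpace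

variable {d : ℕ} {f : Distn d}

/-- If the push-forward of `a f` under a smooth map `w` annihilates all polynomials, it annihilates
all test functions. The regularizations of the push-forward are continuous functions with compact
support and vanishing moments. -/
theorem pairing_mul_comp_eq_zero (hf : IsCompact (Distribution.dsupport f)) {a : Rd d → ℝ}
    {w : Rd d → Rd d} (ha : ContDiff ℝ ∞ a) (hw : ContDiff ℝ ∞ w)
    (h : ∀ (v : Rd d) (n : ℕ), f.pairing (fun y => a y * ⟪v, w y⟫ ^ n) = 0) {ρ : Rd d → ℝ}
    (hρ : ContDiff ℝ ∞ ρ) (hρs : HasCompactSupport ρ) :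
    f.pairing (fun y => a y * ρ (w y)) = 0 := by
  obtain ⟨K, hK, hfK⟩ := exists_compact_superset hf
  have hKS : ∀ᶠ y in 𝓝ˢ (Distribution.dsupport f), y ∈ K :=
    Filter.mem_of_superset (isOpen_interior.mem_nhdsSet.2 hfK) interior_subset
  obtain ⟨M, hM⟩ := (hK.image hw.continuous).isBounded.exists_norm_le
  obtain ⟨R, hR⟩ := hρs.isCompact.isBounded.exists_norm_le
  set L : Set (Rd d) := Metric.closedBall 0 (R + M)
  have hL : IsCompact L := isCompact_closedBall _ _
  have hρ0 : ∀ x ∉ L, ∀ y ∈ K, ρ (x + w y) = 0 := by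
    intro x hx y hy
    refine image_eq_zero_of_notMem_tsupport fun hxy => hx ?_
    have h1 := hR _ hxy
    have h2 := hM _ (mem_image_of_mem w hy)
    have h3 := norm_sub_le (x + w y) (w y)
    rw [add_sub_cancel_right] at h3
    simp only [L, mem_closedBall_zero_iff]
    linarith
  have hG : ContDiff ℝ ∞ fun p : Rd d × Rd d => a p.2 * ρ (p.1 + w p.2) := by fun_prop
  set H : Rd d → ℂ := fun x => f.pairing fun y => a y * ρ (x + w y) with hH
  have hHc : Continuous H := (contDiff_pairing hf hG).continuous
  have hH0 : ∀ x ∉ L, H x = 0 := by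
    intro x hx
    have : f.pairing (fun y => a y * ρ (x + w y)) = f.pairing fun y => 0 * a y := by
      refine pairing_congr ?_
      filter_upwards [hKS] with y hy
      rw [hρ0 x hx y hy]
      ring
    rw [hH]
    simp only
    rw [this, pairing_const_mul hf ha]
    simp
  have hHz : H = 0 := by
    refine eq_zero_of_moments_eq_zero hHc (HasCompactSupport.intro hL hH0) fun v n => ?_
    have hGn : ContDiff ℝ ∞ fun p : Rd d × Rd d => ⟪v, p.1⟫ ^ n * (a p.2 * ρ (p.1 + w p.2)) :=
      ((contDiff_const.inner ℝ contDiff_fst).pow n).mul hG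
    have h1 : ∀ x, ((⟪v, x⟫ ^ n : ℝ) : ℂ) * H x =
        f.pairing fun y => ⟪v, x⟫ ^ n * (a y * ρ (x + w y)) := fun x =>
      (pairing_const_mul hf (contDiff_section hG x) _).symm
    rw [← setIntegral_eq_integral_of_forall_compl_eq_zero (s := L) fun x hx => by
      rw [hH0 x hx, mul_zero]]
    simp_rw [h1]
    refine (setIntegral_pairing hf hGn hL).trans ?_
    -- The moments of a translate of `ρ` are polynomials in the translation vector.
    set m : ℕ → ℝ := fun k => (-1) ^ (n - k) * (n.choose k) * ∫ x, ⟪v, x⟫ ^ k * ρ x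
    have h2 : ∀ y ∈ K, ∫ x in L, ⟪v, x⟫ ^ n * (a y * ρ (x + w y)) =
        ∑ k ∈ Finset.range (n + 1), m k * (a y * ⟪v, w y⟫ ^ (n - k)) := by
      intro y hy
      rw [setIntegral_eq_integral_of_forall_compl_eq_zero (s := L) fun x hx => by
        rw [hρ0 x hx y hy, mul_zero, mul_zero]]
      have hi : ∀ k : ℕ, Integrable fun x => ⟪v, x⟫ ^ k * ρ x := fun k =>
        Continuous.integrable_of_hasCompactSupport
          (((continuous_const.inner continuous_id).pow k).mul hρ.continuous) hρs.mul_left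
      have h3 : ∀ x, ⟪v, x - w y⟫ ^ n * (a y * ρ x) = ∑ k ∈ Finset.range (n + 1),
          ((-1) ^ (n - k) * (n.choose k) * (a y * ⟪v, w y⟫ ^ (n - k))) * (⟪v, x⟫ ^ k * ρ x) := by
        intro x
        rw [inner_sub_right, sub_eq_add_neg, add_pow, Finset.sum_mul]
        refine Finset.sum_congr rfl fun k _ => ?_
        rw [neg_pow ⟪v, w y⟫]
        ring
      rw [← integral_sub_right_eq_self _ (w y)]
      simp only [sub_add_cancel]
      simp_rw [h3]
      rw [integral_finsetSum _ fun k _ => (hi k).const_mul _]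
      refine Finset.sum_congr rfl fun k _ => ?_
      rw [integral_const_mul]
      ring
    have h4 : f.pairing (fun y => ∫ x in L, ⟪v, x⟫ ^ n * (a y * ρ (x + w y))) =
        f.pairing fun y => ∑ k ∈ Finset.range (n + 1), m k * (a y * ⟪v, w y⟫ ^ (n - k)) := by
      refine pairing_congr ?_
      filter_upwards [hKS] with y hy using h2 y hy
    have h5 : ∀ k, ContDiff ℝ ∞ fun y => a y * ⟪v, w y⟫ ^ k := fun k =>
      ha.mul ((contDiff_const.inner ℝ hw).pow k)
    rw [h4, pairing_sum hf _ fun k _ => contDiff_const.mul (h5 _)]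
    refine Finset.sum_eq_zero fun k _ => ?_
    rw [pairing_const_mul hf (h5 _), h, mul_zero]
  have := congrFun hHz 0
  simpa [hH] using this

end Distn

/-! ### Potentials off the support -/

/-- A function that is smooth away from the origin agrees outside a small ball with a smooth
function. -/
theorem exists_contDiff_eq_off_ball {E F : Type*} [NormedAddCommGroup E] [InnerProductSpace ℝ E]
    [FiniteDimensional ℝ E] [NormedAddCommGroup F] [NormedSpace ℝ F]
    {h : E → F} (hh : ContDiffOn ℝ ∞ h {0}ᶜ) {ε : ℝ} (hε : 0 < ε) :
    ∃ g : E → F, ContDiff ℝ ∞ g ∧ ∀ z, ε < ‖z‖ → g z = h z := by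
  let b : ContDiffBump (0 : E) := ⟨ε / 2, ε, by positivity, by linarith⟩
  refine ⟨fun z => (1 - b z) • h z, ?_, fun z hz => ?_⟩
  · refine contDiff_iff_contDiffAt.2 fun z => ?_
    rcases eq_or_ne z 0 with rfl | hz
    · refine (contDiffAt_const (c := (0 : F))).congr_of_eventuallyEq ?_
      filter_upwards [b.eventuallyEq_one] with y hy
      simp [hy]
    · exact (contDiffAt_const.sub b.contDiffAt).smul
        (hh.contDiffAt (isOpen_compl_singleton.mem_nhds hz))
  · have : b z = 0 := b.zero_of_le_dist (by simpa using hz.le)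
    simp [this]

/-- Points near a compact set and points near a disjoint closed set are uniformly separated. -/
theorem exists_separation {E : Type*} [SeminormedAddCommGroup E] {L S : Set E} (hL : IsCompact L)
    (hS : IsClosed S) (hLS : Disjoint L S) : ∃ ε : ℝ, 0 < ε ∧
      ∀ x ∈ Metric.thickening ε L, ∀ y ∈ Metric.thickening ε S, ε < ‖x - y‖ := by
  obtain ⟨δ, hδ, hd⟩ := hLS.exists_thickenings hL hS
  refine ⟨δ / 3, by positivity, fun x hx y hy => ?_⟩
  by_contra hxy
  obtain ⟨z, hz, hxz⟩ := Metric.mem_thickening_iff.1 hx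
  refine disjoint_left.1 hd (Metric.mem_thickening_iff.2 ⟨z, hz, ?_⟩)
    (Metric.thickening_mono (by linarith) S hy)
  have := dist_triangle y x z
  rw [dist_comm y x, dist_eq_norm x y] at this
  linarith

namespace Distn

variable {d : ℕ}

/-- The potential `f * h` off the support of `f`, for a kernel `h` that is smooth away from the
origin. -/
noncomputable def potential (f : Distn d) (h : Rd d → ℝ) (x : Rd d) : ℂ :=
  f.pairing fun y => h (x - y)

variable {f : Distn d} {h h₁ h₂ : Rd d → ℝ}

theorem thickening_mem_nhdsSet {E : Type*} [PseudoEMetricSpace E] (s : Set E) {ε : ℝ}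
    (hε : 0 < ε) : Metric.thickening ε s ∈ 𝓝ˢ s :=
  Metric.isOpen_thickening.mem_nhdsSet.2 (Metric.self_subset_thickening hε s)

/-- Near a compact set `L` disjoint from the support, the potential only depends on the kernel away
from the origin, so the kernel may be taken smooth everywhere. -/
theorem exists_smooth_kernel (hh : ContDiffOn ℝ ∞ h {0}ᶜ) {L : Set (Rd d)} (hL : IsCompact L)
    (hLS : Disjoint L (Distribution.dsupport f)) :
    ∃ g : Rd d → ℝ, ContDiff ℝ ∞ g ∧ ∀ᶠ x in 𝓝ˢ L, ∀ᶠ y in 𝓝ˢ (Distribution.dsupport f),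
      g =ᶠ[𝓝 (x - y)] h := by
  obtain ⟨ε, hε, hsep⟩ := exists_separation hL Distribution.isClosed_dsupport hLS
  obtain ⟨g, hg, hgh⟩ := exists_contDiff_eq_off_ball hh hε
  refine ⟨g, hg, ?_⟩
  filter_upwards [thickening_mem_nhdsSet L hε] with x hx
  filter_upwards [thickening_mem_nhdsSet (Distribution.dsupport f) hε] with y hy
  filter_upwards [(isOpen_lt continuous_const continuous_norm).mem_nhds (hsep x hx y hy)] with z hz
    using hgh z hz

theorem potential_eq_of_kernel_eq {g : Rd d → ℝ} {x : Rd d}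
    (hg : ∀ᶠ y in 𝓝ˢ (Distribution.dsupport f), g =ᶠ[𝓝 (x - y)] h) :
    f.potential h x = f.potential g x := by
  refine pairing_congr ?_
  filter_upwards [hg] with y hy using hy.eq_of_nhds.symm

theorem eventually_notMem_dsupport {x : Rd d} (hx : x ∉ Distribution.dsupport f) :
    ∀ᶠ y in 𝓝ˢ (Distribution.dsupport f), x - y ≠ 0 := by
  have : {x}ᶜ ∈ 𝓝ˢ (Distribution.dsupport f) :=
    isOpen_compl_singleton.mem_nhdsSet.2 fun y hy hyx => hx (by rwa [← mem_singleton_iff.1 hyx])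
  filter_upwards [this] with y hy h0
  exact hy (sub_eq_zero.1 h0).symm

theorem potential_congr (h12 : EqOn h₁ h₂ {0}ᶜ) {x : Rd d} (hx : x ∉ Distribution.dsupport f) :
    f.potential h₁ x = f.potential h₂ x := by
  refine pairing_congr ?_
  filter_upwards [eventually_notMem_dsupport hx] with y hy using h12 hy

variable (hf : IsCompact (Distribution.dsupport f))
include hf

omit hf in
theorem contDiff_kernel {g : Rd d → ℝ} (hg : ContDiff ℝ ∞ g) :
    ContDiff ℝ ∞ fun p : Rd d × Rd d => g (p.1 - p.2) :=
  hg.comp (contDiff_fst.sub contDiff_snd)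

theorem contDiffAt_potential (hh : ContDiffOn ℝ ∞ h {0}ᶜ) {x : Rd d}
    (hx : x ∉ Distribution.dsupport f) : ContDiffAt ℝ ∞ (f.potential h) x := by
  obtain ⟨g, hg, hgh⟩ := exists_smooth_kernel hh isCompact_singleton
    (disjoint_singleton_left.2 hx)
  rw [nhdsSet_singleton] at hgh
  refine (contDiff_pairing hf (contDiff_kernel hg)).contDiffAt.congr_of_eventuallyEq ?_
  filter_upwards [hgh] with x' hx' using potential_eq_of_kernel_eq hx'

theorem fderiv_potential (hh : ContDiffOn ℝ ∞ h {0}ᶜ) {x : Rd d}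
    (hx : x ∉ Distribution.dsupport f) (v : Rd d) :
    fderiv ℝ (f.potential h) x v = f.potential (fun z => fderiv ℝ h z v) x := by
  obtain ⟨g, hg, hgh⟩ := exists_smooth_kernel hh isCompact_singleton
    (disjoint_singleton_left.2 hx)
  rw [nhdsSet_singleton] at hgh
  have h1 : f.potential h =ᶠ[𝓝 x] fun x => f.pairing fun y => g (x - y) := by
    filter_upwards [hgh] with x' hx' using potential_eq_of_kernel_eq hx'
  rw [h1.fderiv_eq]
  refine (fderiv_pairing hf (contDiff_kernel hg) x v).trans (pairing_congr ?_)
  filter_upwards [hgh.self_of_nhds] with y hy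
  have h2 := (hasFDerivAt_partialFst (contDiff_kernel hg) x y).fderiv
  rw [← h2, ← hy.fderiv_eq, fderiv_comp_sub (f := g) (x := x) y]

theorem potential_add (hh₁ : ContDiffOn ℝ ∞ h₁ {0}ᶜ) (hh₂ : ContDiffOn ℝ ∞ h₂ {0}ᶜ) {x : Rd d}
    (hx : x ∉ Distribution.dsupport f) :
    f.potential (fun z => h₁ z + h₂ z) x = f.potential h₁ x + f.potential h₂ x := by
  obtain ⟨g₁, hg₁, hgh₁⟩ := exists_smooth_kernel hh₁ isCompact_singleton
    (disjoint_singleton_left.2 hx)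
  obtain ⟨g₂, hg₂, hgh₂⟩ := exists_smooth_kernel hh₂ isCompact_singleton
    (disjoint_singleton_left.2 hx)
  rw [nhdsSet_singleton] at hgh₁ hgh₂
  rw [potential_eq_of_kernel_eq hgh₁.self_of_nhds, potential_eq_of_kernel_eq hgh₂.self_of_nhds]
  refine Eq.trans ?_ (pairing_add hf (contDiff_section (contDiff_kernel hg₁) x)
    (contDiff_section (contDiff_kernel hg₂) x))
  refine pairing_congr ?_
  filter_upwards [hgh₁.self_of_nhds, hgh₂.self_of_nhds] with y h1 h2
  rw [h1.eq_of_nhds, h2.eq_of_nhds]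

theorem potential_const_mul (hh : ContDiffOn ℝ ∞ h {0}ᶜ) (c : ℝ) {x : Rd d}
    (hx : x ∉ Distribution.dsupport f) :
    f.potential (fun z => c * h z) x = c * f.potential h x := by
  obtain ⟨g, hg, hgh⟩ := exists_smooth_kernel hh isCompact_singleton
    (disjoint_singleton_left.2 hx)
  rw [nhdsSet_singleton] at hgh
  rw [potential_eq_of_kernel_eq hgh.self_of_nhds]
  refine Eq.trans ?_ (pairing_const_mul hf (contDiff_section (contDiff_kernel hg) x) c)
  refine pairing_congr ?_
  filter_upwards [hgh.self_of_nhds] with y h1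
  rw [h1.eq_of_nhds]

/-- The distribution `f * h` is given by the function `potential f h` off the support of `f`. -/
theorem integral_smul_potential (hh : ContDiffOn ℝ ∞ h {0}ᶜ) (φ : TestFn d)
    (hφ : Disjoint (tsupport φ) (Distribution.dsupport f)) :
    ∫ x, φ x • f.potential h x = f.pairing fun y => ∫ x, φ x * h (x - y) := by
  have hL : IsCompact (tsupport φ) := φ.hasCompactSupport
  have hφ0 : ∀ x ∉ tsupport φ, φ x = 0 := fun x hx => image_eq_zero_of_notMem_tsupport hx
  obtain ⟨ε, hε, hsep⟩ := exists_separation hL Distribution.isClosed_dsupport hφ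
  obtain ⟨g, hg, hgh⟩ := exists_contDiff_eq_off_ball hh hε
  have hG : ContDiff ℝ ∞ fun p : Rd d × Rd d => φ p.1 * g (p.1 - p.2) :=
    (φ.contDiff.comp contDiff_fst).mul (contDiff_kernel hg)
  have h1 : ∀ x, φ x • f.potential h x = f.pairing fun y => φ x * g (x - y) := by
    intro x
    rw [pairing_const_mul hf (contDiff_section (contDiff_kernel hg) x), Complex.real_smul]
    by_cases hx : x ∈ tsupport φ
    · congr 1
      refine pairing_congr ?_
      filter_upwards [thickening_mem_nhdsSet (Distribution.dsupport f) hε] with y hy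
      exact (hgh _ (hsep x (Metric.self_subset_thickening hε _ hx) y hy)).symm
    · simp [hφ0 x hx]
  have h2 := setIntegral_pairing (μ := volume) hf hG hL
  rw [setIntegral_eq_integral_of_forall_compl_eq_zero fun x hx => by
    rw [← h1, hφ0 x hx, zero_smul]] at h2
  rw [integral_congr_ae (Eventually.of_forall h1)]
  refine h2.trans (pairing_congr ?_)
  filter_upwards [thickening_mem_nhdsSet (Distribution.dsupport f) hε] with y hy
  rw [setIntegral_eq_integral_of_forall_compl_eq_zero fun x hx => by
    simp only [hφ0 x hx, zero_mul]]
  refine integral_congr_ae (Eventually.of_forall fun x => ?_)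
  by_cases hx : x ∈ tsupport φ
  · simp only [hgh _ (hsep x (Metric.self_subset_thickening hε _ hx) y hy)]
  · simp only [hφ0 x hx, zero_mul]

/-! ### Flat kernels -/

/-- The kernel `h` is flat for `f` at `x₀` if it is smooth away from the origin and `f * h` vanishes
to infinite order at `x₀`. -/
def IsFlatKernel (f : Distn d) (x₀ : Rd d) (h : Rd d → ℝ) : Prop :=
  ContDiffOn ℝ ∞ h {0}ᶜ ∧ ∀ n, iteratedFDeriv ℝ n (f.potential h) x₀ = 0

variable {x₀ : Rd d} (hx₀ : x₀ ∉ Distribution.dsupport f)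
include hx₀

omit hf in
theorem eventually_off_dsupport : ∀ᶠ x in 𝓝 x₀, x ∉ Distribution.dsupport f :=
  Distribution.isClosed_dsupport.isOpen_compl.mem_nhds hx₀

omit hf in
theorem IsFlatKernel.congr (hh : IsFlatKernel f x₀ h₁) (h12 : EqOn h₂ h₁ {0}ᶜ) :
    IsFlatKernel f x₀ h₂ := by
  refine ⟨hh.1.congr h12, fun n => ?_⟩
  have : f.potential h₂ =ᶠ[𝓝 x₀] f.potential h₁ := by
    filter_upwards [eventually_off_dsupport hx₀] with x hx using potential_congr h12 hx
  rw [(this.iteratedFDeriv ℝ n).eq_of_nhds, hh.2 n]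

theorem IsFlatKernel.directionalDeriv (hh : IsFlatKernel f x₀ h) (v : Rd d) :
    IsFlatKernel f x₀ fun z => fderiv ℝ h z v := by
  refine ⟨(hh.1.fderiv_of_isOpen isOpen_compl_singleton (m := ∞) (by simp)).clm_apply
    contDiffOn_const, fun n => ?_⟩
  have h1 : f.potential (fun z => fderiv ℝ h z v) =ᶠ[𝓝 x₀]
      ContinuousLinearMap.apply ℝ ℂ v ∘ fderiv ℝ (f.potential h) := by
    filter_upwards [eventually_off_dsupport hx₀] with x hx
    exact (fderiv_potential hf hh.1 hx v).symm
  have h2 : ContDiffAt ℝ ∞ (fderiv ℝ (f.potential h)) x₀ :=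
    (contDiffAt_potential hf hh.1 hx₀).fderiv_right (by simp)
  rw [(h1.iteratedFDeriv ℝ n).eq_of_nhds,
    ContinuousLinearMap.iteratedFDeriv_comp_left _ h2 (mod_cast le_top)]
  have h3 : iteratedFDeriv ℝ n (fderiv ℝ (f.potential h)) x₀ = 0 := by
    rw [← norm_eq_zero, norm_iteratedFDeriv_fderiv, hh.2, norm_zero]
  rw [h3]
  ext m
  simp

theorem IsFlatKernel.add (hh₁ : IsFlatKernel f x₀ h₁) (hh₂ : IsFlatKernel f x₀ h₂) :
    IsFlatKernel f x₀ fun z => h₁ z + h₂ z := by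
  refine ⟨hh₁.1.add hh₂.1, fun n => ?_⟩
  have h1 : f.potential (fun z => h₁ z + h₂ z) =ᶠ[𝓝 x₀] f.potential h₁ + f.potential h₂ := by
    filter_upwards [eventually_off_dsupport hx₀] with x hx using potential_add hf hh₁.1 hh₂.1 hx
  rw [(h1.iteratedFDeriv ℝ n).eq_of_nhds, iteratedFDeriv_add_apply
    ((contDiffAt_potential hf hh₁.1 hx₀).of_le (mod_cast le_top))
    ((contDiffAt_potential hf hh₂.1 hx₀).of_le (mod_cast le_top)), hh₁.2, hh₂.2, add_zero]

theorem IsFlatKernel.const_mul (hh : IsFlatKernel f x₀ h) (c : ℝ) :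
    IsFlatKernel f x₀ fun z => c * h z := by
  refine ⟨contDiffOn_const.mul hh.1, fun n => ?_⟩
  have h1 : f.potential (fun z => c * h z) =ᶠ[𝓝 x₀] c • f.potential h := by
    filter_upwards [eventually_off_dsupport hx₀] with x hx
    rw [potential_const_mul hf hh.1 c hx, Pi.smul_apply, Complex.real_smul]
  rw [(h1.iteratedFDeriv ℝ n).eq_of_nhds, iteratedFDeriv_const_smul_apply
    ((contDiffAt_potential hf hh.1 hx₀).of_le (mod_cast le_top)), hh.2, smul_zero]

theorem IsFlatKernel.sum {ι : Type*} (s : Finset ι) (hs : s.Nonempty) {k : ι → Rd d → ℝ}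
    (hk : ∀ i, IsFlatKernel f x₀ (k i)) : IsFlatKernel f x₀ fun z => ∑ i ∈ s, k i z := by
  induction hs using Finset.Nonempty.cons_induction with
  | singleton i => simpa using hk i
  | cons i s hi _ ih =>
    simp only [Finset.sum_cons]
    exact IsFlatKernel.add hf hx₀ (hk i) ih

end Distn

/-! ### Powers of the norm as flat kernels, and inversion -/

section Kernels

open scoped RealInnerProductSpace

/-- The kernel `(v · z)^n |z|^{2s}`, homogeneous of degree `n + 2s`. -/
noncomputable def polyKernel {E : Type*} [NormedAddCommGroup E] [InnerProductSpace ℝ E] (v : E)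
    (n : ℕ) (s : ℝ) (z : E) : ℝ :=
  ⟪v, z⟫ ^ n * (‖z‖ ^ 2) ^ s

variable {E : Type*} [NormedAddCommGroup E] [InnerProductSpace ℝ E]

theorem contDiffOn_norm_sq_rpow (s : ℝ) : ContDiffOn ℝ ∞ (fun z : E => (‖z‖ ^ 2) ^ s) {0}ᶜ :=
  (contDiff_norm_sq ℝ).contDiffOn.rpow_const_of_ne fun _ hz =>
    pow_ne_zero 2 (norm_ne_zero_iff.2 hz)

theorem fderiv_polyKernel (v : E) (n : ℕ) (s : ℝ) {z : E} (hz : z ≠ 0) :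
    fderiv ℝ (polyKernel v n s) z v =
      n * ‖v‖ ^ 2 * polyKernel v (n - 1) s z + 2 * s * polyKernel v (n + 1) (s - 1) z := by
  have h1 : HasFDerivAt (fun z : E => ⟪v, z⟫) (innerSL ℝ v) z := (innerSL ℝ v).hasFDerivAt
  have h2 := (hasStrictFDerivAt_norm_sq z).hasFDerivAt
  have h3 := h2.rpow_const (p := s) (Or.inl (pow_ne_zero 2 (norm_ne_zero_iff.2 hz)))
  have h4 := ((h1.pow n).mul h3).fderiv
  have h5 : fderiv ℝ (polyKernel v n s) z = _ := h4
  rw [h5]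
  simp only [polyKernel, add_apply, smul_apply, innerSL_apply_apply, smul_eq_mul, nsmul_eq_mul,
    real_inner_self_eq_norm_sq, real_inner_comm z v]
  ring

end Kernels

namespace Distn

open scoped RealInnerProductSpace

variable {d : ℕ} {f : Distn d} (hf : IsCompact (Distribution.dsupport f)) {x₀ : Rd d}
  (hx₀ : x₀ ∉ Distribution.dsupport f)
include hf hx₀

/-- The Laplacian of `|z|^{2s}` is `2s (2s + d - 2) |z|^{2s - 2}`, so flatness passes from `s`
to `s - 1` unless the factor vanishes. -/
theorem IsFlatKernel.norm_sq_rpow_sub_one (hd : 0 < d) {s : ℝ} (hs : s ≠ 0)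
    (hs' : d + 2 * s - 2 ≠ 0) (h : IsFlatKernel f x₀ fun z => (‖z‖ ^ 2) ^ s) :
    IsFlatKernel f x₀ fun z => (‖z‖ ^ 2) ^ (s - 1) := by
  have key : ∀ i : Fin d, IsFlatKernel f x₀ fun z =>
      polyKernel (EuclideanSpace.single i (1 : ℝ)) 0 (s - 1) z +
        2 * (s - 1) * polyKernel (EuclideanSpace.single i (1 : ℝ)) 2 (s - 1 - 1) z := by
    intro i
    set e : Rd d := EuclideanSpace.single i (1 : ℝ)
    have he : ‖e‖ = 1 := by simp [e]
    have h0 : IsFlatKernel f x₀ (polyKernel e 0 s) := h.congr hx₀ fun z _ => by simp [polyKernel]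
    have h1 : IsFlatKernel f x₀ (polyKernel e 1 (s - 1)) := by
      refine ((h0.directionalDeriv hf hx₀ e).const_mul hf hx₀ (2 * s)⁻¹).congr hx₀ fun z hz => ?_
      rw [fderiv_polyKernel e 0 s hz]
      simp only [Nat.cast_zero, zero_mul, zero_add]
      rw [inv_mul_cancel_left₀ (mul_ne_zero two_ne_zero hs)]
    refine (h1.directionalDeriv hf hx₀ e).congr hx₀ fun z hz => ?_
    rw [fderiv_polyKernel e 1 (s - 1) hz, he]
    simp
  have : Nonempty (Fin d) := ⟨⟨0, hd⟩⟩
  refine ((IsFlatKernel.sum hf hx₀ Finset.univ Finset.univ_nonempty key).const_mul hf hx₀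
    (d + 2 * s - 2)⁻¹).congr hx₀ fun z hz => ?_
  have hz2 : 0 < ‖z‖ ^ 2 := by have := norm_pos_iff.2 hz; positivity
  simp only [polyKernel, pow_zero, one_mul]
  rw [Finset.sum_add_distrib, ← Finset.mul_sum, ← Finset.sum_mul]
  have h2 : ∑ i : Fin d, ⟪EuclideanSpace.single i (1 : ℝ), z⟫ ^ 2 = ‖z‖ ^ 2 := by
    rw [EuclideanSpace.real_norm_sq_eq]
    simp [EuclideanSpace.inner_single_left]
  rw [h2, Real.rpow_sub_one hz2.ne' (s - 1), mul_div_cancel₀ _ hz2.ne']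
  simp only [Finset.sum_const, Finset.card_univ, Fintype.card_fin, nsmul_eq_mul]
  rw [eq_inv_mul_iff_mul_eq₀ hs']
  ring

theorem IsFlatKernel.norm_sq_rpow_sub_nat (hd : 0 < d) {s : ℝ} (hs : ∀ k : ℕ, s - k ≠ 0)
    (hs' : ∀ k : ℕ, d + 2 * (s - k) - 2 ≠ 0) (h : IsFlatKernel f x₀ fun z => (‖z‖ ^ 2) ^ s)
    (k : ℕ) : IsFlatKernel f x₀ fun z => (‖z‖ ^ 2) ^ (s - k) := by
  induction k with
  | zero => simpa using h
  | succ k ih =>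
    have := ih.norm_sq_rpow_sub_one hf hx₀ hd (hs k) (hs' k)
    rwa [sub_sub, ← Nat.cast_succ] at this

/-- Differentiating `(v · z)^n |z|^{2s}` along `v` gives a multiple of `(v · z)^{n+1} |z|^{2s-2}` up
to a term with a lower power of `v · z`. -/
theorem IsFlatKernel.polyKernel_sub (hd : 0 < d) {s : ℝ} (hs : ∀ k : ℕ, s - k ≠ 0)
    (hs' : ∀ k : ℕ, d + 2 * (s - k) - 2 ≠ 0) (h : IsFlatKernel f x₀ fun z => (‖z‖ ^ 2) ^ s)
    (v : Rd d) (n k : ℕ) : IsFlatKernel f x₀ (polyKernel v n (s - (k + n : ℕ))) := by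
  induction n using Nat.strong_induction_on generalizing k with
  | _ n ih =>
    match n with
    | 0 =>
      refine (h.norm_sq_rpow_sub_nat hf hx₀ hd hs hs' k).congr hx₀ fun z _ => ?_
      simp [polyKernel]
    | n + 1 =>
      set t : ℝ := s - (k + n : ℕ) with ht
      have ht1 : s - (k + (n + 1) : ℕ) = t - 1 := by rw [ht]; push_cast; ring
      rw [ht1]
      have h1 : IsFlatKernel f x₀ (polyKernel v n t) := ih n n.lt_succ_self k
      have h2 : IsFlatKernel f x₀ fun z => n * ‖v‖ ^ 2 * polyKernel v (n - 1) t z := by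
        rcases Nat.eq_zero_or_pos n with rfl | hn
        · refine (h1.const_mul hf hx₀ 0).congr hx₀ fun z _ => ?_
          simp
        · have := ih (n - 1) (by omega) (k + 1)
          rw [show k + 1 + (n - 1) = k + n by omega] at this
          exact this.const_mul hf hx₀ _
      have hts : 2 * t ≠ 0 := mul_ne_zero two_ne_zero (hs _)
      refine (((h1.directionalDeriv hf hx₀ v).add hf hx₀
        (h2.const_mul hf hx₀ (-1))).const_mul hf hx₀ (2 * t)⁻¹).congr hx₀ fun z hz => ?_
      rw [fderiv_polyKernel v n t hz, eq_inv_mul_iff_mul_eq₀ hts]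
      ring

/-- If the Riesz potential of `f` with a non-exceptional exponent `-2s` vanishes to infinite order
at a point `x₀` off the support, then `f = 0`. In the inverted coordinate
`w = (y - x₀) / |y - x₀|²`, the distribution `|y - x₀|^{2s} f` annihilates all polynomials. -/
theorem eq_zero_of_isFlatKernel (hd : 0 < d) {s : ℝ} (hs : ∀ k : ℕ, s - k ≠ 0)
    (hs' : ∀ k : ℕ, d + 2 * (s - k) - 2 ≠ 0) (h : IsFlatKernel f x₀ fun z => (‖z‖ ^ 2) ^ s) :
    f = 0 := by
  -- Near the support, `ε < |y - x₀| < R`.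
  obtain ⟨ε, hε, hsep⟩ := exists_separation isCompact_singleton Distribution.isClosed_dsupport
    (disjoint_singleton_left.2 hx₀)
  obtain ⟨R, hR0, hR⟩ : ∃ R : ℝ, 0 < R ∧ ∀ y ∈ Distribution.dsupport f, ‖y - x₀‖ < R := by
    obtain ⟨R, hR⟩ := hf.isBounded.subset_ball x₀
    refine ⟨max R 1, by positivity, fun y hy => ?_⟩
    have := hR hy
    rw [Metric.mem_ball, dist_eq_norm] at this
    exact this.trans_le (le_max_left _ _)
  have hnear : ∀ᶠ y in 𝓝ˢ (Distribution.dsupport f), ε < ‖y - x₀‖ ∧ ‖y - x₀‖ < R := by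
    filter_upwards [thickening_mem_nhdsSet (Distribution.dsupport f) hε,
      (Metric.isOpen_ball (x := x₀) (ε := R)).mem_nhdsSet.2 (fun y hy => by
        rw [Metric.mem_ball, dist_eq_norm]; exact hR y hy)] with y hy hy'
    refine ⟨?_, by rwa [Metric.mem_ball, dist_eq_norm] at hy'⟩
    rw [norm_sub_rev]
    exact hsep x₀ (Metric.self_subset_thickening hε _ rfl) y hy
  obtain ⟨g₁, hg₁, hg₁s⟩ := exists_contDiff_eq_off_ball (contDiffOn_norm_sq_rpow (E := Rd d) s) hε
  obtain ⟨g₂, hg₂, hg₂s⟩ := exists_contDiff_eq_off_ball (E := Rd d)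
    (h := fun z => (‖z‖ ^ 2)⁻¹ • z)
    (((contDiff_norm_sq ℝ).contDiffOn.inv fun z hz =>
      pow_ne_zero 2 (norm_ne_zero_iff.2 hz)).smul contDiffOn_id) hε
  have ha : ContDiff ℝ ∞ fun y => g₁ (y - x₀) := hg₁.comp (contDiff_id.sub contDiff_const)
  have hw : ContDiff ℝ ∞ fun y => g₂ (y - x₀) := hg₂.comp (contDiff_id.sub contDiff_const)
  have hmom : ∀ (v : Rd d) (n : ℕ),
      f.pairing (fun y => g₁ (y - x₀) * ⟪v, g₂ (y - x₀)⟫ ^ n) = 0 := by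
    intro v n
    -- The potential at `x₀` involves `x₀ - y`, whence the sign of `v`.
    have h1 := (h.polyKernel_sub hf hx₀ hd hs hs' (-v) n 0).2 0
    have h2 : f.potential (polyKernel (-v) n (s - (0 + n : ℕ))) x₀ = 0 := by
      rw [← norm_eq_zero, ← norm_iteratedFDeriv_zero (𝕜 := ℝ), h1, norm_zero]
    rw [← h2]
    refine pairing_congr ?_
    filter_upwards [hnear] with y hy
    have hpos : 0 < ‖y - x₀‖ ^ 2 := by have := hε.trans hy.1; positivity
    rw [hg₁s _ hy.1, hg₂s _ hy.1, polyKernel, inner_smul_right, norm_sub_rev x₀ y,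
      ← neg_sub y x₀, inner_neg_neg, zero_add, Real.rpow_sub_natCast hpos.ne', mul_pow, inv_pow]
    field_simp
  ext φ
  change f φ = 0
  -- The test function `φ`, divided by the weight and expressed in the inverted coordinate.
  have hφ' : ContDiffOn ℝ ∞ (fun w : Rd d => (‖w‖ ^ 2) ^ s * φ (x₀ + (‖w‖ ^ 2)⁻¹ • w)) {0}ᶜ := by
    refine (contDiffOn_norm_sq_rpow s).mul (φ.contDiff.comp_contDiffOn
      (contDiffOn_const.add (((contDiff_norm_sq ℝ).contDiffOn.inv fun z hz =>
        pow_ne_zero 2 (norm_ne_zero_iff.2 hz)).smul contDiffOn_id)))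
  obtain ⟨ρ, hρ, hρs⟩ := exists_contDiff_eq_off_ball hφ' (inv_pos.2 hR0)
  -- Near the support `|w| < ε⁻¹`, so a cutoff at that radius is harmless.
  let b : ContDiffBump (0 : Rd d) := ⟨ε⁻¹, ε⁻¹ + 1, by positivity, by linarith⟩
  have h0 := pairing_mul_comp_eq_zero hf ha hw hmom (b.contDiff.mul hρ)
    (b.hasCompactSupport.mul_right)
  rw [← h0]
  refine (pairing_eq f _ φ ?_).symm
  filter_upwards [hnear] with y hy
  set z := y - x₀ with hz
  have hzpos : 0 < ‖z‖ := hε.trans hy.1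
  have hnorm : ‖(‖z‖ ^ 2)⁻¹ • z‖ = ‖z‖⁻¹ := by
    rw [norm_smul, norm_inv, norm_pow, norm_norm]
    field_simp
  have hb : b ((‖z‖ ^ 2)⁻¹ • z) = 1 := by
    refine b.one_of_mem_closedBall ?_
    rw [mem_closedBall_zero_iff, hnorm]
    exact inv_anti₀ hε hy.1.le
  rw [hg₁s z hy.1, hg₂s z hy.1, hb, one_mul, hρs _ (by
    rw [hnorm]; exact inv_strictAnti₀ hzpos hy.2), hnorm, smul_smul, ← mul_assoc,
    ← Real.mul_rpow (by positivity) (by positivity)]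
  have h3 : ‖z‖ ^ 2 * ‖z‖⁻¹ ^ 2 = 1 := by field_simp
  have h4 : (‖z‖⁻¹ ^ 2)⁻¹ * (‖z‖ ^ 2)⁻¹ = 1 := by field_simp
  rw [h3, h4, Real.one_rpow, one_mul, one_smul, hz, add_sub_cancel]

end Distn

/-! ### The normal operator in polar coordinates -/

section Polar

variable {E : Type*} [NormedAddCommGroup E] [NormedSpace ℝ E] [FiniteDimensional ℝ E]
  [MeasurableSpace E] [BorelSpace E] [Nontrivial E]

/-- Integration in polar coordinates. -/
theorem integral_polar (μ : Measure E) [μ.IsAddHaarMeasure] {g : E → ℝ} (hg : Integrable g μ) :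
    Integrable (fun θ : Metric.sphere (0 : E) 1 =>
        ∫ r in Ioi (0 : ℝ), r ^ (Module.finrank ℝ E - 1) * g (r • (θ : E))) μ.toSphere ∧
      ∫ x, g x ∂μ = ∫ θ : Metric.sphere (0 : E) 1,
        (∫ r in Ioi (0 : ℝ), r ^ (Module.finrank ℝ E - 1) * g (r • (θ : E))) ∂μ.toSphere := by
  set n := Module.finrank ℝ E - 1
  set G : Metric.sphere (0 : E) 1 × Ioi (0 : ℝ) → ℝ := fun p => g ((p.2 : ℝ) • (p.1 : E))
  have hG : ∀ x : ({0}ᶜ : Set E), G (homeomorphUnitSphereProd E x) = g x := by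
    intro x
    have h1 : ((homeomorphUnitSphereProd E).symm (homeomorphUnitSphereProd E x) : E) = x := by
      rw [Homeomorph.symm_apply_apply]
    rw [homeomorphUnitSphereProd_symm_apply_coe] at h1
    exact congrArg g h1
  have hmp := μ.measurePreserving_homeomorphUnitSphereProd
  have hemb : MeasurableEmbedding (homeomorphUnitSphereProd E) :=
    Homeomorph.measurableEmbedding _
  have hr : ∀ θ, ∫ r : Ioi (0 : ℝ), G (θ, r) ∂(Measure.volumeIoiPow n) =
      ∫ r in Ioi (0 : ℝ), r ^ n * g (r • (θ : E)) := by
    intro θ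
    rw [← integral_subtype_comap measurableSet_Ioi fun r : ℝ => r ^ n * g (r • (θ : E)),
      Measure.volumeIoiPow]
    simp only [ENNReal.ofReal]
    rw [integral_withDensity_eq_integral_smul (by fun_prop)]
    refine integral_congr_ae (Eventually.of_forall fun r => ?_)
    simp only [G, NNReal.smul_def, smul_eq_mul]
    rw [Real.coe_toNNReal _ (pow_nonneg (le_of_lt r.2) _)]
  have hintg : Integrable G (μ.toSphere.prod (Measure.volumeIoiPow n)) := by
    rw [← hmp.integrable_comp_emb hemb]
    have h1 : Integrable (fun x : ({0}ᶜ : Set E) => g x) (μ.comap (↑)) :=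
      (MeasurableEmbedding.subtype_coe
        (measurableSet_singleton (0 : E)).compl).integrableOn_range_iff_comap.1 hg.integrableOn
    exact h1.congr (Eventually.of_forall fun x => (hG x).symm)
  simp_rw [← hr]
  refine ⟨hintg.integral_prod_left, ?_⟩
  rw [← integral_prod _ hintg, ← hmp.integral_comp hemb]
  simp_rw [hG]
  rw [integral_subtype_comap (measurableSet_singleton _).compl g, restrict_compl_singleton]

end Polar

variable {d : ℕ}

/-- Away from the support of `φ`, the function `X^* X φ` is twice the Riesz potential of order
`d - 1`: the lines through `y` sweep out the space twice, with density `|x - y|^{1 - d}`. -/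
theorem xrayAdjoint_xray_eq (hd : 0 < d) (φ : TestFn d) {y : Rd d} (hy : y ∉ tsupport φ) :
    xrayAdjoint (xray φ) y = 2 * ∫ x, φ x * ‖x - y‖ ^ (-((d : ℝ) - 1)) := by
  have : Nontrivial (Rd d) := by
    have : Nonempty (Fin d) := ⟨⟨0, hd⟩⟩
    infer_instance
  set g : Rd d → ℝ := fun z => φ (y + z) * ‖z‖ ^ (-((d : ℝ) - 1)) with hg
  have hφy : HasCompactSupport fun z => φ (y + z) :=
    φ.hasCompactSupport.comp_homeomorph (Homeomorph.addLeft y)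
  have hgs : HasCompactSupport g := hφy.mul_right
  have hgc : Continuous g := by
    refine continuous_iff_continuousAt.2 fun z => ?_
    rcases eq_or_ne z 0 with rfl | hz
    · refine (continuousAt_const (y := (0 : ℝ))).congr ?_
      have h0 : Tendsto (fun z => y + z) (𝓝 0) (𝓝 y) := by
        have : Continuous fun z : Rd d => y + z := by fun_prop
        simpa using this.tendsto 0
      filter_upwards [h0.eventually (notMem_tsupport_iff_eventuallyEq.1 hy)] with z hz
      simp [hg, hz]
    · exact (φ.continuous.comp (by fun_prop)).continuousAt.mul
        (continuous_norm.continuousAt.rpow_const (Or.inl (norm_ne_zero_iff.2 hz)))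
  have hgi : Integrable g := hgc.integrable_of_hasCompactSupport hgs
  have hθ : ∀ θ : Metric.sphere (0 : Rd d) 1, ‖(θ : Rd d)‖ = 1 := fun θ => norm_eq_of_mem_sphere θ
  have hrad : ∀ (θ : Metric.sphere (0 : Rd d) 1) (r : ℝ), 0 < r → ∀ e : ℝ, |e| = 1 →
      r ^ (Module.finrank ℝ (Rd d) - 1) * g (e • r • (θ : Rd d)) =
        φ (y + (e * r) • (θ : Rd d)) := by
    intro θ r hr e he
    have h1 : ‖e • r • (θ : Rd d)‖ = r := by
      rw [norm_smul, norm_smul, hθ, Real.norm_eq_abs, Real.norm_eq_abs, he, abs_of_pos hr]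
      ring
    simp only [hg]
    have h2 : (d : ℝ) - 1 = (d - 1 : ℕ) := by rw [Nat.cast_sub hd, Nat.cast_one]
    rw [h1, finrank_euclideanSpace_fin, Real.rpow_neg hr.le, h2, Real.rpow_natCast, smul_smul]
    field_simp
  obtain ⟨hA, hgA⟩ := integral_polar volume hgi
  obtain ⟨hB, hgB⟩ := integral_polar volume hgi.comp_neg
  have hline : ∀ θ : Metric.sphere (0 : Rd d) 1, xray φ (lineThrough y θ) =
      (∫ r in Ioi (0 : ℝ), r ^ (Module.finrank ℝ (Rd d) - 1) * g (r • (θ : Rd d))) +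
        ∫ r in Ioi (0 : ℝ), r ^ (Module.finrank ℝ (Rd d) - 1) * g (-(r • (θ : Rd d))) := by
    intro θ
    set ℓ : ℝ → ℝ := fun s => φ (y + s • (θ : Rd d)) with hℓ
    have hiso : Isometry fun s : ℝ => y + s • (θ : Rd d) := by
      refine Isometry.of_dist_eq fun s t => ?_
      rw [dist_add_left, dist_eq_norm, ← sub_smul, norm_smul, hθ, mul_one, dist_eq_norm]
    have hi : Integrable ℓ := (φ.continuous.comp hiso.continuous).integrable_of_hasCompactSupport
      (φ.hasCompactSupport.comp_isClosedEmbedding hiso.isClosedEmbedding)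
    have h1 : xray φ (lineThrough y θ) = ∫ s, ℓ s := by
      rw [← integral_sub_right_eq_self ℓ (inner ℝ y (θ : Rd d))]
      refine integral_congr_ae (Eventually.of_forall fun s => ?_)
      simp only [lineThrough, hℓ]
      congr 1
      module
    rw [h1, ← intervalIntegral.integral_Iic_add_Ioi (b := 0) hi.integrableOn hi.integrableOn,
      add_comm]
    congr 1
    · refine setIntegral_congr_fun measurableSet_Ioi fun r hr => ?_
      have := hrad θ r hr 1 abs_one
      rw [one_smul, one_mul] at this
      exact this.symm
    · have h2 := integral_comp_neg_Ioi 0 ℓ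
      rw [neg_zero] at h2
      rw [← h2]
      refine setIntegral_congr_fun measurableSet_Ioi fun r hr => ?_
      have := hrad θ r hr (-1) (by simp)
      rw [neg_one_smul, neg_one_mul] at this
      exact this.symm
  simp only [xrayAdjoint]
  simp_rw [hline]
  rw [integral_add hA hB, ← hgA, ← hgB, integral_neg_eq_self g, ← two_mul,
    ← integral_sub_right_eq_self g y]
  simp [hg]

theorem rpow_norm_eq (α : ℝ) (z : Rd d) : ‖z‖ ^ (-α) = (‖z‖ ^ 2) ^ (-α / 2) := by
  rw [← Real.rpow_natCast_mul (norm_nonneg z)]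
  congr 1
  push_cast
  ring

theorem rieszPotential_eq (α : ℝ) (f : Distn d) (φ : TestFn d) :
    rieszPotential α f φ = f.pairing fun y => ∫ x, φ x * (‖x - y‖ ^ 2) ^ (-α / 2) := by
  simp only [rieszPotential, Distn.conv]
  congr 1
  ext1 y
  rw [convolution_mul_swap]
  refine integral_congr_ae (Eventually.of_forall fun x => ?_)
  simp only
  rw [neg_sub, rpow_norm_eq, mul_comm]

theorem normalOperator_eq (hd : 0 < d) (f : Distn d) (φ : TestFn d)
    (hφ : Disjoint (tsupport φ) (Distribution.dsupport f)) :
    normalOperator f φ =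
      f.pairing fun y => ∫ x, φ x * (2 * (‖x - y‖ ^ 2) ^ (-((d : ℝ) - 1) / 2)) := by
  refine Distn.pairing_congr ?_
  have : (tsupport φ)ᶜ ∈ 𝓝ˢ (Distribution.dsupport f) :=
    (isClosed_tsupport φ).isOpen_compl.mem_nhdsSet.2 hφ.subset_compl_left
  filter_upwards [this] with y hy
  rw [xrayAdjoint_xray_eq hd φ hy, ← integral_const_mul]
  refine integral_congr_ae (Eventually.of_forall fun x => ?_)
  simp only
  rw [rpow_norm_eq]
  ring

/-! ### Unique continuation -/

namespace Distn

variable {f : Distn d} {h : Rd d → ℝ} {T : TestFn d → ℂ}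

theorem isGivenOnBy_potential (hf : IsCompact (Distribution.dsupport f))
    (hh : ContDiffOn ℝ ∞ h {0}ᶜ)
    (hT : ∀ φ : TestFn d, Disjoint (tsupport φ) (Distribution.dsupport f) →
      T φ = f.pairing fun y => ∫ x, φ x * h (x - y))
    {V : Set (Rd d)} (hV : Disjoint V (Distribution.dsupport f)) :
    IsGivenOnBy T V (f.potential h) := by
  refine ⟨fun x hx => (contDiffAt_potential hf hh (disjoint_left.1 hV hx)).contDiffWithinAt,
    fun φ hφ => ?_⟩
  rw [hT φ (hV.mono_left hφ), integral_smul_potential hf hh φ (hV.mono_left hφ)]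

/-- A smooth function that represents a functional near a point is determined near that point. -/
theorem _root_.IsGivenOnBy.eqOn_inter {U V : Set (Rd d)} {u v : Rd d → ℂ} (hu : IsGivenOnBy T U u)
    (hv : IsGivenOnBy T V v) (hU : IsOpen U) (hV : IsOpen V) : EqOn u v (U ∩ V) := by
  have huc : ContinuousOn u (U ∩ V) := hu.1.continuousOn.mono inter_subset_left
  have hvc : ContinuousOn v (U ∩ V) := hv.1.continuousOn.mono inter_subset_right
  have hUV := hU.inter hV
  have hae := hUV.ae_eq_zero_of_integral_contDiff_smul_eq_zero
    (μ := volume) (f := fun x => u x - v x)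
    ((huc.sub hvc).locallyIntegrableOn hUV.measurableSet) fun g hg hgs hgt => by
      let φ : TestFn d := ⟨g, hg, hgs, subset_univ _⟩
      have hi : ∀ w : Rd d → ℂ, ContinuousOn w (U ∩ V) → Integrable fun x => g x • w x := by
        intro w hw
        refine Continuous.integrable_of_hasCompactSupport ?_ hgs.smul_right
        exact continuous_iff_continuousAt.2 fun x => by
          by_cases hx : x ∈ tsupport g
          · exact hg.continuous.continuousAt.smul (hw.continuousAt (hUV.mem_nhds (hgt hx)))
          · refine (continuousAt_const (y := (0 : ℂ))).congr ?_
            filter_upwards [notMem_tsupport_iff_eventuallyEq.1 hx] with z hz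
            simp [hz]
      have h1 : T φ = ∫ x, g x • u x := hu.2 φ (hgt.trans inter_subset_left)
      have h2 : T φ = ∫ x, g x • v x := hv.2 φ (hgt.trans inter_subset_right)
      simp_rw [smul_sub]
      rw [integral_sub (hi u huc) (hi v hvc), ← h1, ← h2, sub_self]
  refine Measure.eqOn_open_of_ae_eq (μ := volume) ?_ hUV huc hvc
  rw [EventuallyEq, ae_restrict_iff' hUV.measurableSet]
  filter_upwards [hae] with x hx hxU using sub_eq_zero.1 (hx hxU)

/-- A smooth function representing `T` near `x₀` agrees there with the potential, so it does not
matter which one is differentiated. -/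
theorem isFlatKernel_of_vanishesToInfiniteOrderAt (hf : IsCompact (Distribution.dsupport f))
    (hh : ContDiffOn ℝ ∞ h {0}ᶜ)
    (hT : ∀ φ : TestFn d, Disjoint (tsupport φ) (Distribution.dsupport f) →
      T φ = f.pairing fun y => ∫ x, φ x * h (x - y))
    {x₀ : Rd d} (hx₀ : x₀ ∉ Distribution.dsupport f) (hv : VanishesToInfiniteOrderAt T x₀) :
    IsFlatKernel f x₀ h := by
  obtain ⟨U, u, hU, hxU, hu, hzero⟩ := hv
  have hV : IsOpen (Distribution.dsupport f)ᶜ := Distribution.isClosed_dsupport.isOpen_compl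
  have heq := hu.eqOn_inter (isGivenOnBy_potential hf hh hT disjoint_compl_left) hU hV
  have hev : f.potential h =ᶠ[𝓝 x₀] u := by
    filter_upwards [(hU.inter hV).mem_nhds ⟨hxU, hx₀⟩] with x hx using (heq hx).symm
  refine ⟨hh, fun n => ?_⟩
  rw [(hev.iteratedFDeriv ℝ n).eq_of_nhds]
  refine ContinuousMultilinearMap.toMultilinearMap_injective ?_
  refine Module.Basis.ext_multilinear (fun _ => (EuclideanSpace.basisFun (Fin d) ℝ).toBasis)
    fun m => ?_
  simpa using hzero n m

end Distn

theorem theorem1 (d : ℕ) (hd : 2 ≤ d) (f : Distn d)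
    (hf : IsCompact (Distribution.dsupport f))
    (V : Set (Rd d)) (hV : IsOpen V) (x₀ : Rd d) (hx₀ : x₀ ∈ V)
    (hfV : Distribution.IsVanishingOn f V) :
    (∀ α : ℝ, (α = (d : ℝ) - 1 ∨ ((∀ k : ℤ, α ≠ (k : ℝ)) ∧ α < (d : ℝ))) →
      (∃ u : Rd d → ℂ, IsGivenOnBy (rieszPotential α f) V u) ∧
      (VanishesToInfiniteOrderAt (rieszPotential α f) x₀ → f = 0)) ∧
    (∃ u : Rd d → ℂ, IsGivenOnBy (normalOperator f) V u) ∧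
    (VanishesToInfiniteOrderAt (normalOperator f) x₀ → f = 0) := by
  have hd0 : 0 < d := by omega
  have hd1 : (1 : ℝ) < d := by exact_mod_cast hd
  have hVS : Disjoint V (Distribution.dsupport f) := hfV.disjoint_dsupport hV
  have hx₀S : x₀ ∉ Distribution.dsupport f := disjoint_left.1 hVS hx₀
  -- The exponents excluded by the Laplacian and by the directional derivatives are integers.
  have hα : ∀ α : ℝ, (α = (d : ℝ) - 1 ∨ ((∀ k : ℤ, α ≠ (k : ℝ)) ∧ α < (d : ℝ))) →
      (∀ k : ℕ, -α / 2 - k ≠ 0) ∧ ∀ k : ℕ, (d : ℝ) + 2 * (-α / 2 - k) - 2 ≠ 0 := by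
    rintro α (rfl | ⟨hα, -⟩)
    · refine ⟨fun k hk => ?_, fun k hk => ?_⟩
      · have : (0 : ℝ) ≤ k := k.cast_nonneg
        linarith
      · have h1 : ((2 * k : ℤ) : ℝ) = ((-1 : ℤ) : ℝ) := by push_cast; linarith
        have := Int.cast_injective h1
        omega
    · refine ⟨fun k hk => hα (-2 * k) ?_, fun k hk => hα (d - 2 - 2 * k) ?_⟩ <;>
      · push_cast
        linarith
  refine ⟨fun α h => ?_, ?_⟩
  · have hT : ∀ φ : TestFn d, Disjoint (tsupport φ) (Distribution.dsupport f) →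
        rieszPotential α f φ = f.pairing fun y => ∫ x, φ x * (‖x - y‖ ^ 2) ^ (-α / 2) :=
      fun φ _ => rieszPotential_eq α f φ
    have hs := contDiffOn_norm_sq_rpow (E := Rd d) (-α / 2)
    exact ⟨⟨_, Distn.isGivenOnBy_potential hf hs hT hVS⟩, fun hv =>
      Distn.eq_zero_of_isFlatKernel hf hx₀S hd0 (hα α h).1 (hα α h).2
        (Distn.isFlatKernel_of_vanishesToInfiniteOrderAt hf hs hT hx₀S hv)⟩
  · have hs := contDiffOn_const (c := (2 : ℝ)).mul
      (contDiffOn_norm_sq_rpow (E := Rd d) (-((d : ℝ) - 1) / 2))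
    have hT := normalOperator_eq hd0 f
    refine ⟨⟨_, Distn.isGivenOnBy_potential hf hs hT hVS⟩, fun hv => ?_⟩
    have hflat := (Distn.isFlatKernel_of_vanishesToInfiniteOrderAt hf hs hT hx₀S hv).const_mul
      hf hx₀S 2⁻¹
    have h1 := hα (d - 1) (Or.inl rfl)
    refine Distn.eq_zero_of_isFlatKernel hf hx₀S hd0 h1.1 h1.2 (hflat.congr hx₀S fun z _ => ?_)
    simp
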